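/- For positive integers $h, N$ let $$T(h,N) = \bigl|\{(x_1,x_2,x_3,x_4)\in\mathbb{Z}^4 : x_1x_4-x_2x_3=h,\ -N\le x_i\le N \text{ for } 1\le i\le 4\}\bigr|$$ and $$E(h,N) = T(h,N) - \Bigl(\frac{8}{\zeta(2)}-4\Bigr)N^2\sum_{d\mid h}\frac1d,$$ where $\zeta$ is the Riemann zeta function and $d$ runs over the positive divisors of $h$. Then for every $A>0$ and every $\varepsilon>0$ there is a constant $C=C(A,\varepsilon)>0$ such that $$|E(h,N)|\le C\,N^{1+\varepsilon}$$ for all positive integers $h,N$ with $|h-N^2|\le A N$. (That is, if $h=N^2+O(N)$, then $E(h,N)\ll_\varepsilon N^{1+\varepsilon}$.) -/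

import Mathlib

/-- The set of integer points `x = (x₁, x₂, x₃, x₄)` in the box `[-N, N]⁴` satisfying
`x₁ x₄ - x₂ x₃ = h` (the coordinates are indexed from `0`). -/
noncomputable def detSolutions (h N : ℕ) : Finset (Fin 4 → ℤ) :=
  (Fintype.piFinset fun _ : Fin 4 => Finset.Icc (-(N : ℤ)) (N : ℤ)).filter
    fun x => x 0 * x 3 - x 1 * x 2 = (h : ℤ)

/-- `T(h, N)`: the number of integer points of the box `[-N, N]⁴` on the quadric
`x₁ x₄ - x₂ x₃ = h`. -/
noncomputable def detCount (h N : ℕ) : ℕ := (detSolutions h N).card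

/-- `E(h, N) = T(h, N) - (8 ζ(2)⁻¹ - 4) N² ∑_{d ∣ h} 1/d`.  The value `ζ(2)` of the Riemann zeta
function is a real number; Mathlib's `riemannZeta` is complex-valued, hence the `.re`. -/
noncomputable def detError (h N : ℕ) : ℝ :=
  (detCount h N : ℝ) -
    (8 * ((riemannZeta 2).re)⁻¹ - 4) * (N : ℝ) ^ 2 * ∑ d ∈ h.divisors, (1 : ℝ) / (d : ℝ)

/-!
A solution of `x₁ x₄ - x₂ x₃ = h` is a pair `u, v ∈ [-N, N]²` with `det (u, v) = h`, that is, a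
positively oriented basis, inside the box, of a sublattice of `ℤ²` of index `h`. Suppose first that
`N² < h ≤ (N + 1)²`. Inside one lattice, the determinant of two vectors of the box is a multiple of
`h` of absolute value at most `2 N² < 2 h`, so any two non-proportional primitive vectors of the
lattice in the box form a basis of it. Three pairwise non-proportional ones would be, up to sign,
`u`, `v`, `u + v`, which forces `h ≤ N²` (`rowDet_le_sq`). So each lattice has `0`, `2` or `4`
primitive vectors in the box, and with `n` of them it contributes `0`, `2 n - 4 = 0` or
`2 n - 4 = 4` bases. Summing over lattices (`detCount_add_four_mul`),
`T(h, N) = 2 ∑ n - 4 σ(h) + 4 · #{lattices with n = 0}`.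

* There are `σ(h) = h ∑_{d ∣ h} 1 / d` lattices of index `h`, by Hermite normal form.
* A nonzero vector `u` is primitive in `gcd u` of them if `gcd u ∣ h`, and in none otherwise
  (`card_filter_latPrim`). So `∑ n = ∑_{g ∣ h} g R(N / g)`, where `R(K) = 4 K² / ζ(2) + O(K log K)`
  counts the vectors with coprime coordinates in `[-K, K]²`.
* By the pigeonhole principle every lattice has a primitive vector in the box of radius `N + 1`.
  Those with none in the box of radius `N` are therefore at most
  `∑ gcd u` over the boundary `|u| = N + 1`, which is `O(N τ(N + 1))`.

This is the claim with error `N ^ (1 + ε)`, by the divisor bound `τ(n) ≪ n ^ δ`. For the general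
case take `M` with `M² < h ≤ (M + 1)²`; then `|M - N| = O(1)`, and each enlargement of the box from
radius `B - 1` to `B` adds only `O(∑_{|u| = B} gcd u) = O(B τ(B))` solutions
(`detCount_succ_le`).
-/

/-! ### Lattices in Hermite normal form -/

/-- The determinant of the matrix with rows `u`, `v`. -/
def rowDet (u v : ℤ × ℤ) : ℤ := u.1 * v.2 - u.2 * v.1

/-- Membership in the lattice of `ℤ²` generated by `(g, 0)` and `(r, k)` (Hermite normal form). -/
def HermiteMem (g k r : ℤ) (u : ℤ × ℤ) : Prop :=
  ∃ s t : ℤ, u = (s * g + t * r, t * k)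

/-- `u` is a primitive vector of the lattice generated by `(g, 0)` and `(r, k)`: its coordinates
with respect to this basis are coprime. -/
def HermitePrim (g k r : ℤ) (u : ℤ × ℤ) : Prop :=
  ∃ s t : ℤ, IsCoprime s t ∧ u = (s * g + t * r, t * k)

theorem HermitePrim.mem {g k r : ℤ} {u : ℤ × ℤ} (h : HermitePrim g k r u) :
    HermiteMem g k r u := by
  obtain ⟨s, t, -, rfl⟩ := h
  exact ⟨s, t, rfl⟩

theorem HermitePrim.neg {g k r : ℤ} {u : ℤ × ℤ} (h : HermitePrim g k r u) :
    HermitePrim g k r (-u) := by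
  obtain ⟨s, t, hc, rfl⟩ := h
  refine ⟨-s, -t, hc.neg_neg, ?_⟩
  ext <;> simp; ring

theorem HermitePrim.ne_zero {g k r : ℤ} (hg : g ≠ 0) (hk : k ≠ 0) {u : ℤ × ℤ}
    (h : HermitePrim g k r u) : u ≠ 0 := by
  obtain ⟨s, t, hc, rfl⟩ := h
  intro h0
  obtain ⟨h1, h2⟩ := Prod.mk_eq_zero.1 h0
  have ht : t = 0 := by simpa [hk] using h2
  have hs : s = 0 := by simpa [ht, hg] using h1
  rw [hs, ht] at hc
  exact not_isCoprime_zero_zero hc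

theorem HermiteMem.add_zsmul {g k r : ℤ} {u v : ℤ × ℤ} (hu : HermiteMem g k r u)
    (hv : HermiteMem g k r v) (n : ℤ) : HermiteMem g k r (u + n • v) := by
  obtain ⟨s, t, rfl⟩ := hu
  obtain ⟨s', t', rfl⟩ := hv
  refine ⟨s + n * s', t + n * t', ?_⟩
  ext <;> simp <;> ring

theorem HermiteMem.dvd_rowDet {g k r : ℤ} {u v : ℤ × ℤ} (hu : HermiteMem g k r u)
    (hv : HermiteMem g k r v) : g * k ∣ rowDet u v := by
  obtain ⟨s, t, rfl⟩ := hu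
  obtain ⟨s', t', rfl⟩ := hv
  exact ⟨s * t' - t * s', by simp only [rowDet]; ring⟩

/-- Two lattice vectors spanning the full covolume are primitive. -/
theorem HermiteMem.prim_of_rowDet_eq {g k r : ℤ} (hg : g ≠ 0) (hk : k ≠ 0) {u v : ℤ × ℤ}
    (hu : HermiteMem g k r u) (hv : HermiteMem g k r v) (h : rowDet u v = g * k) :
    HermitePrim g k r u ∧ HermitePrim g k r v := by
  obtain ⟨s, t, rfl⟩ := hu
  obtain ⟨s', t', rfl⟩ := hv
  have h1 : g * k * (s * t' - t * s') = g * k * 1 := by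
    simp only [rowDet] at h; linear_combination h
  have h2 := mul_left_cancel₀ (mul_ne_zero hg hk) h1
  exact ⟨⟨s, t, ⟨t', -s', by linear_combination h2⟩, rfl⟩,
    ⟨s', t', ⟨-t, s, by linear_combination h2⟩, rfl⟩⟩

/-- A primitive vector extends to a basis. -/
theorem HermitePrim.exists_rowDet_eq {g k r : ℤ} {u : ℤ × ℤ} (hu : HermitePrim g k r u) :
    ∃ v, HermiteMem g k r v ∧ rowDet u v = g * k := by
  obtain ⟨s, t, ⟨a, b, hab⟩, rfl⟩ := hu
  refine ⟨_, ⟨-b, a, rfl⟩, ?_⟩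
  simp only [rowDet]
  linear_combination (g * k) * hab

theorem HermitePrim.exists_eq_zsmul {g k r : ℤ} (hg : g ≠ 0) (hk : k ≠ 0) {u v : ℤ × ℤ}
    (hu : HermitePrim g k r u) (hv : HermiteMem g k r v) (h : rowDet u v = 0) :
    ∃ n : ℤ, v = n • u := by
  obtain ⟨s, t, ⟨a, b, hab⟩, rfl⟩ := hu
  obtain ⟨s', t', rfl⟩ := hv
  have h1 : g * k * (s * t' - t * s') = g * k * 0 := by
    simp only [rowDet] at h; linear_combination h
  have h2 := mul_left_cancel₀ (mul_ne_zero hg hk) h1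
  have h3 : s' = (a * s' + b * t') * s := by linear_combination (-s') * hab + (-b) * h2
  have h4 : t' = (a * s' + b * t') * t := by linear_combination (-t') * hab + a * h2
  refine ⟨a * s' + b * t', ?_⟩
  ext
  · simp only [Prod.smul_mk, smul_eq_mul]; linear_combination g * h3 + r * h4
  · simp only [Prod.smul_mk, smul_eq_mul]; linear_combination k * h4

theorem HermitePrim.eq_or_eq_neg {g k r : ℤ} (hg : g ≠ 0) (hk : k ≠ 0) {u v : ℤ × ℤ}
    (hu : HermitePrim g k r u) (hv : HermitePrim g k r v) (h : rowDet u v = 0) :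
    v = u ∨ v = -u := by
  obtain ⟨n, hn⟩ := hu.exists_eq_zsmul hg hk hv.mem h
  obtain ⟨m, hm⟩ := hv.exists_eq_zsmul hg hk hu.mem (by simp only [rowDet] at *; linarith)
  have h0 : (n * m - 1) • v = 0 := by
    rw [sub_smul, mul_smul, ← hm, ← hn]; simp
  have h1 : n * m = 1 := by
    rcases smul_eq_zero.1 h0 with h | h
    · linarith
    · exact absurd h (hv.ne_zero hg hk)
  rcases Int.eq_one_or_neg_one_of_mul_eq_one h1 with rfl | rfl
  · left; simpa using hn
  · right; simpa using hn

/-- Existence of the Hermite normal form of the lattice spanned by `u`, `v`. -/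
theorem exists_hermiteMem {h : ℤ} (hh : 0 < h) {u v : ℤ × ℤ} (huv : rowDet u v = h) :
    ∃ g k r : ℤ, 0 < g ∧ 0 < k ∧ 0 ≤ r ∧ r < g ∧ g * k = h ∧
      HermiteMem g k r u ∧ HermiteMem g k r v := by
  obtain ⟨a, b⟩ := u
  obtain ⟨c, d⟩ := v
  simp only [rowDet] at huv
  have hk0 : (Int.gcd b d : ℤ) ≠ 0 := by
    intro h0
    have := Int.gcd_eq_zero_iff.1 (by exact_mod_cast h0 : Int.gcd b d = 0)
    rw [this.1, this.2] at huv; simp at huv; omega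
  have hk : (0 : ℤ) < Int.gcd b d := by positivity
  have hbez := Int.gcd_eq_gcd_ab b d
  set k : ℤ := (Int.gcd b d : ℤ)
  set p := Int.gcdA b d
  set q := Int.gcdB b d
  obtain ⟨t, ht⟩ : k ∣ b := Int.gcd_dvd_left ..
  obtain ⟨t', ht'⟩ : k ∣ d := Int.gcd_dvd_right ..
  have hgk : (a * t' - c * t) * k = h := by rw [← huv, ht, ht']; ring
  set g := a * t' - c * t with hg
  have hg0 : 0 < g := pos_of_mul_pos_left (hgk ▸ hh) hk.le
  have hone : t * p + t' * q = 1 := by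
    apply mul_left_cancel₀ hk0
    rw [ht, ht'] at hbez; linear_combination -hbez
  refine ⟨g, k, (p * a + q * c) % g, hg0, hk, Int.emod_nonneg _ hg0.ne', Int.emod_lt_of_pos _ hg0,
    hgk, ⟨q + t * ((p * a + q * c) / g), t, ?_⟩, ⟨-p + t' * ((p * a + q * c) / g), t', ?_⟩⟩
  · have := Int.emod_add_mul_ediv (p * a + q * c) g
    ext
    · simp only
      linear_combination (-t) * this - a * hone - q * hg
    · simp [ht, mul_comm]
  · have := Int.emod_add_mul_ediv (p * a + q * c) g
    ext
    · simp only
      linear_combination (-t') * this - c * hone + p * hg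
    · simp [ht', mul_comm]

/-- Uniqueness of the Hermite normal form. -/
theorem hermite_unique {g k r g' k' r' : ℤ} (hg : 0 < g) (hk : 0 < k)
    (hk' : 0 < k') (hr : 0 ≤ r) (hrg : r < g) (hr' : 0 ≤ r') (hrg' : r' < g')
    (hh : g * k = g' * k') {u v : ℤ × ℤ} (huv : rowDet u v = g * k)
    (hu : HermiteMem g k r u) (hv : HermiteMem g k r v)
    (hu' : HermiteMem g' k' r' u) (hv' : HermiteMem g' k' r' v) :
    g = g' ∧ k = k' ∧ r = r' := by
  have hg'0 : 0 < g' := by linarith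
  have key : ∀ {g k r : ℤ}, 0 < g → 0 < k → rowDet u v = g * k → ∀ s t s' t' : ℤ,
      u = (s * g + t * r, t * k) → v = (s' * g + t' * r, t' * k) → s * t' - t * s' = 1 := by
    intro g k r hg hk h s t s' t' h1 h2
    have : g * k * (s * t' - t * s') = g * k * 1 := by
      rw [h1, h2] at h
      simp only [rowDet] at h; linear_combination h
    exact mul_left_cancel₀ (mul_pos hg hk).ne' this
  obtain ⟨s, t, h1⟩ := hu
  obtain ⟨s', t', h2⟩ := hv
  obtain ⟨x, y, h3⟩ := hu'
  obtain ⟨x', y', h4⟩ := hv'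
  have e1 := key hg hk huv s t s' t' h1 h2
  have e2 := key hg'0 hk' (huv.trans hh) x y x' y' h3 h4
  rw [h1] at h3
  rw [h2] at h4
  simp only [Prod.mk.injEq] at h3 h4
  obtain ⟨h3, h5⟩ := h3
  obtain ⟨h4, h6⟩ := h4
  have hkk : k = k' := by
    apply Int.dvd_antisymm hk.le hk'.le
    · exact ⟨x * t' - x' * t, by linear_combination (-k') * e2 - x * h6 + x' * h5⟩
    · exact ⟨s * y' - s' * y, by linear_combination (-k) * e1 + s * h6 - s' * h5⟩
  subst hkk
  have hgg : g = g' := mul_right_cancel₀ hk.ne' hh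
  subst hgg
  have ht : t = y := mul_right_cancel₀ hk.ne' h5
  have ht' : t' = y' := mul_right_cancel₀ hk.ne' h6
  subst ht ht'
  have hd : g ∣ r - r' := ⟨s * (x' - s') - s' * (x - s), by
    linear_combination (-(r - r')) * e1 + s * h4 - s' * h3⟩
  refine ⟨rfl, rfl, ?_⟩
  have := Int.eq_zero_of_abs_lt_dvd hd (abs_lt.2 ⟨by linarith, by linarith⟩)
  linarith

/-- Pigeonhole form of Minkowski's theorem for the sup norm. -/
theorem exists_hermitePrim {g k r M : ℕ} (hg : 0 < g) (hk : 0 < k) (hM : g * k ≤ M ^ 2) :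
    ∃ u : ℤ × ℤ, HermitePrim g k r u ∧ |u.1| ≤ M ∧ |u.2| ≤ M := by
  classical
  -- two of the `(M + 1) ^ 2` points of `[0, M]²` are congruent modulo the lattice
  obtain ⟨p, hp, q, hq, hpq, hf⟩ := Finset.exists_ne_map_eq_of_card_lt_of_maps_to
    (s := Finset.Icc (0 : ℤ) M ×ˢ Finset.Icc (0 : ℤ) M)
    (t := Finset.Ico (0 : ℤ) g ×ˢ Finset.Ico (0 : ℤ) k)
    (f := fun p => ((p.1 - r * (p.2 / k)) % g, p.2 % k))
    (by simp; nlinarith)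
    (by
      intro p _
      have hg' : (0 : ℤ) < g := by exact_mod_cast hg
      have hk' : (0 : ℤ) < k := by exact_mod_cast hk
      simp [Int.emod_nonneg _ hg'.ne', Int.emod_lt_of_pos _ hg', Int.emod_nonneg _ hk'.ne',
        Int.emod_lt_of_pos _ hk'])
  simp only [Prod.mk.injEq] at hf
  obtain ⟨hf1, hf2⟩ := hf
  obtain ⟨s, hs⟩ := Int.ModEq.dvd hf1.symm
  have e1 := Int.emod_add_mul_ediv p.2 k
  have e2 := Int.emod_add_mul_ediv q.2 k
  set t := p.2 / (k : ℤ) - q.2 / k with ht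
  have hw : p - q = (s * g + t * r, t * k) := by
    ext
    · simp only [Prod.fst_sub]; linear_combination hs
    · simp only [Prod.snd_sub]; linear_combination -e1 + e2 + hf2
  have hst : Int.gcd s t ≠ 0 := by
    intro h0
    obtain ⟨hs0, ht0⟩ := Int.gcd_eq_zero_iff.1 h0
    rw [hs0, ht0] at hw
    simp only [zero_mul, add_zero] at hw
    exact hpq (sub_eq_zero.1 hw)
  have hpos : (0 : ℤ) < Int.gcd s t := by positivity
  obtain ⟨s', hs'⟩ : (Int.gcd s t : ℤ) ∣ s := Int.gcd_dvd_left ..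
  obtain ⟨t', ht'⟩ : (Int.gcd s t : ℤ) ∣ t := Int.gcd_dvd_right ..
  have hb := Int.gcd_eq_gcd_ab s t
  set c : ℤ := (Int.gcd s t : ℤ)
  have hw1 : p.1 - q.1 = c * (s' * g + t' * r) := by
    have := congrArg Prod.fst hw
    simp only [Prod.fst_sub] at this
    rw [this, hs', ht']; ring
  have hw2 : p.2 - q.2 = c * (t' * k) := by
    have := congrArg Prod.snd hw
    simp only [Prod.snd_sub] at this
    rw [this, ht']; ring
  simp only [Finset.mem_product, Finset.mem_Icc] at hp hq
  have hle : ∀ x : ℤ, |x| ≤ |c * x| := by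
    intro x
    rw [abs_mul]
    exact le_mul_of_one_le_left (abs_nonneg x) (hpos.trans_le (le_abs_self c))
  refine ⟨_, ⟨s', t', ⟨Int.gcdA s t, Int.gcdB s t, ?_⟩, rfl⟩, ?_, ?_⟩
  · apply mul_left_cancel₀ hpos.ne'
    linear_combination -hb - (Int.gcdA s t) * hs' - (Int.gcdB s t) * ht'
  · refine (hle _).trans ?_
    rw [← hw1, abs_le]; constructor <;> linarith
  · refine (hle _).trans ?_
    rw [← hw2, abs_le]; constructor <;> linarith

/-- Two vectors of the box `[-N, N]²` whose sum also lies in the box have determinant at most `N²`,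
rather than the trivial `2 N²`. -/
theorem rowDet_le_sq {N : ℤ} {u v : ℤ × ℤ} (hu1 : |u.1| ≤ N) (hu2 : |u.2| ≤ N)
    (hv1 : |v.1| ≤ N) (hv2 : |v.2| ≤ N) (h1 : |u.1 + v.1| ≤ N) (h2 : |u.2 + v.2| ≤ N) :
    rowDet u v ≤ N ^ 2 := by
  obtain ⟨a, b⟩ := u
  obtain ⟨c, d⟩ := v
  simp only [rowDet] at *
  have aux : ∀ x y p q : ℤ, |x| + |y| ≤ N → |p| ≤ N → |q| ≤ N → x * p - y * q ≤ N ^ 2 := by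
    intro x y p q h hp hq
    have h1 : x * p ≤ |x| * N := by
      grw [← hp, ← abs_mul]; exact le_abs_self _
    have h2 : -(y * q) ≤ |y| * N := by
      grw [← hq, ← abs_mul]; exact neg_le_abs _
    have hN : 0 ≤ N := (abs_nonneg _).trans hp
    nlinarith [mul_le_mul_of_nonneg_right h hN]
  -- among `a`, `c`, `-(a + c)` two have the same sign; the determinant is the same for each of
  -- the three pairs of columns
  have h2' : |-(b + d)| ≤ N := by rwa [abs_neg]
  have key : |a| + |c| ≤ N ∨ |c| + |-(a + c)| ≤ N ∨ |-(a + c)| + |a| ≤ N := by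
    simp only [abs_neg]
    rcases abs_cases a with ⟨_, _⟩ | ⟨_, _⟩ <;> rcases abs_cases c with ⟨_, _⟩ | ⟨_, _⟩ <;>
      rcases abs_cases (a + c) with ⟨_, _⟩ | ⟨_, _⟩ <;> omega
  rcases key with h | h | h
  · linarith [aux a c d b h hv2 hu2]
  · linarith [aux c (-(a + c)) (-(b + d)) d h h2' hv2]
  · linarith [aux (-(a + c)) a b (-(b + d)) h hu2 h2']

/-! ### The lattices of a given index -/

/-- The square `[-N, N]²`. -/
noncomputable def box (N : ℕ) : Finset (ℤ × ℤ) := Finset.Icc (-(N : ℤ)) N ×ˢ Finset.Icc (-(N : ℤ)) N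

theorem mem_box {N : ℕ} {u : ℤ × ℤ} : u ∈ box N ↔ |u.1| ≤ N ∧ |u.2| ≤ N := by
  simp [box, abs_le]

theorem neg_mem_box {N : ℕ} {u : ℤ × ℤ} (h : u ∈ box N) : -u ∈ box N := by
  simpa [mem_box] using h

/-- The sublattices of `ℤ²` of index `h`, encoded by Hermite normal form: the pair `⟨g, r⟩` with
`g ∣ h` and `0 ≤ r < g` stands for the lattice generated by `(g, 0)` and `(r, h / g)`. -/
def latticeIndex (h : ℕ) : Finset (Σ _ : ℕ, ℕ) := h.divisors.sigma fun g => Finset.range g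

/-- `u` lies in the lattice of index `h` encoded by `i`. -/
def LatMem (h : ℕ) (i : Σ _ : ℕ, ℕ) (u : ℤ × ℤ) : Prop :=
  HermiteMem i.1 (h / i.1 : ℕ) i.2 u

/-- `u` is a primitive vector of the lattice of index `h` encoded by `i`. -/
def LatPrim (h : ℕ) (i : Σ _ : ℕ, ℕ) (u : ℤ × ℤ) : Prop :=
  HermitePrim i.1 (h / i.1 : ℕ) i.2 u

theorem card_latticeIndex (h : ℕ) : (latticeIndex h).card = ∑ d ∈ h.divisors, d := by
  simp [latticeIndex]

theorem latticeIndex_spec {h : ℕ} {i : Σ _ : ℕ, ℕ} (hi : i ∈ latticeIndex h) :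
    0 < i.1 ∧ 0 < h / i.1 ∧ i.1 * (h / i.1) = h ∧ i.2 < i.1 := by
  simp only [latticeIndex, Finset.mem_sigma, Nat.mem_divisors, Finset.mem_range] at hi
  obtain ⟨⟨hd, h0⟩, hr⟩ := hi
  have h1 := Nat.mul_div_cancel' hd
  refine ⟨by omega, Nat.pos_of_ne_zero fun h2 => ?_, h1, hr⟩
  rw [h2] at h1; omega

theorem latticeIndex_spec_int {h : ℕ} {i : Σ _ : ℕ, ℕ} (hi : i ∈ latticeIndex h) :
    (0 : ℤ) < i.1 ∧ (0 : ℤ) < (h / i.1 : ℕ) ∧ (i.1 : ℤ) * (h / i.1 : ℕ) = h ∧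
      (i.2 : ℤ) < i.1 := by
  obtain ⟨h1, h2, h3, h4⟩ := latticeIndex_spec hi
  exact ⟨by exact_mod_cast h1, by exact_mod_cast h2, by exact_mod_cast h3, by exact_mod_cast h4⟩

theorem exists_latMem {h : ℕ} (hh : 0 < h) {u v : ℤ × ℤ} (huv : rowDet u v = h) :
    ∃ i ∈ latticeIndex h, LatMem h i u ∧ LatMem h i v := by
  obtain ⟨g, k, r, hg, hk, hr, hrg, hgk, hu, hv⟩ :=
    exists_hermiteMem (by exact_mod_cast hh : (0 : ℤ) < h) huv
  lift g to ℕ using hg.le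
  lift k to ℕ using hk.le
  lift r to ℕ using hr
  norm_cast at hg hk hrg hgk
  have hk' : h / g = k := Nat.div_eq_of_eq_mul_right hg hgk.symm
  refine ⟨⟨g, r⟩, ?_, ?_, ?_⟩
  · simp only [latticeIndex, Finset.mem_sigma, Nat.mem_divisors, Finset.mem_range]
    exact ⟨⟨⟨k, hgk.symm⟩, hh.ne'⟩, hrg⟩
  · simpa [LatMem, hk'] using hu
  · simpa [LatMem, hk'] using hv

theorem latMem_unique {h : ℕ} {u v : ℤ × ℤ} (huv : rowDet u v = h) {i j : Σ _ : ℕ, ℕ}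
    (hi : i ∈ latticeIndex h) (hj : j ∈ latticeIndex h) (hiu : LatMem h i u) (hiv : LatMem h i v)
    (hju : LatMem h j u) (hjv : LatMem h j v) : i = j := by
  obtain ⟨a1, a2, a3, a4⟩ := latticeIndex_spec_int hi
  obtain ⟨b1, b2, b3, b4⟩ := latticeIndex_spec_int hj
  obtain ⟨e1, -, e2⟩ := hermite_unique a1 a2 b2 (Int.natCast_nonneg _) a4 (Int.natCast_nonneg _) b4
    (a3.trans b3.symm) (huv.trans a3.symm) hiu hiv hju hjv
  obtain ⟨g, r⟩ := i
  obtain ⟨g', r'⟩ := j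
  simp only [Nat.cast_inj] at e1 e2
  rw [e1, e2]

theorem LatMem.prim {h : ℕ} {i : Σ _ : ℕ, ℕ} (hi : i ∈ latticeIndex h) {u v : ℤ × ℤ}
    (hu : LatMem h i u) (hv : LatMem h i v) (huv : rowDet u v = h) :
    LatPrim h i u ∧ LatPrim h i v := by
  obtain ⟨a1, a2, a3, -⟩ := latticeIndex_spec_int hi
  exact HermiteMem.prim_of_rowDet_eq a1.ne' a2.ne' hu hv (huv.trans a3.symm)

theorem exists_bezout {u : ℤ × ℤ} (hu : u ≠ 0) :
    ∃ u₀ w : ℤ × ℤ, u = (Int.gcd u.1 u.2 : ℤ) • u₀ ∧ rowDet u₀ w = 1 := by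
  obtain ⟨a, b⟩ := u
  have hc : (Int.gcd a b : ℤ) ≠ 0 := by
    intro h0
    obtain ⟨rfl, rfl⟩ := Int.gcd_eq_zero_iff.1 (by exact_mod_cast h0 : Int.gcd a b = 0)
    exact hu rfl
  obtain ⟨a', ha⟩ : (Int.gcd a b : ℤ) ∣ a := Int.gcd_dvd_left ..
  obtain ⟨b', hb⟩ : (Int.gcd a b : ℤ) ∣ b := Int.gcd_dvd_right ..
  refine ⟨(a', b'), (-Int.gcdB a b, Int.gcdA a b), ?_, ?_⟩
  · ext
    · exact ha
    · exact hb
  · apply mul_left_cancel₀ hc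
    have := Int.gcd_eq_gcd_ab a b
    simp only [rowDet]
    linear_combination -this - (Int.gcdA a b) * ha - (Int.gcdB a b) * hb

theorem exists_eq_zsmul_of_rowDet_eq_zero {u w z : ℤ × ℤ} (hw : rowDet u w = 1)
    (hz : rowDet u z = 0) : ∃ m : ℤ, z = m • u := by
  refine ⟨rowDet z w, ?_⟩
  simp only [rowDet] at hw hz ⊢
  ext
  · simp only [Prod.smul_fst, smul_eq_mul]; linear_combination -z.1 * hw + w.1 * hz
  · simp only [Prod.smul_snd, smul_eq_mul]; linear_combination -z.2 * hw + w.2 * hz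

open Classical in
/-- The number of lattices of index `h` in which `u` is primitive. They correspond to the
solutions `v` of `det (u, v) = h` modulo `u`: such a solution exists when `c = gcd u` divides `h`,
and is unique up to multiples of `u / c`. -/
theorem card_filter_latPrim {h : ℕ} (hh : 0 < h) {u : ℤ × ℤ} (hu : u ≠ 0) :
    ((latticeIndex h).filter fun i => LatPrim h i u).card =
      if Int.gcd u.1 u.2 ∣ h then Int.gcd u.1 u.2 else 0 := by
  obtain ⟨u₀, w, hu₀, hdet⟩ := exists_bezout hu
  have hc : 0 < Int.gcd u.1 u.2 := Nat.pos_of_ne_zero fun h0 => hu (by rw [hu₀, h0]; simp)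
  set c := Int.gcd u.1 u.2
  have hu1 : u.1 = c * u₀.1 := by rw [hu₀]; simp
  have hu2 : u.2 = c * u₀.2 := by rw [hu₀]; simp
  have hcz : (c : ℤ) ≠ 0 := by exact_mod_cast hc.ne'
  have key : ∀ z : ℤ × ℤ, rowDet u z = 0 → ∃ m : ℤ, z = m • u₀ := fun z hz =>
    exists_eq_zsmul_of_rowDet_eq_zero hdet (mul_left_cancel₀ hcz (by
      simp only [rowDet, hu1, hu2] at hz ⊢; linear_combination hz))
  split_ifs with hdvd
  · obtain ⟨e, he⟩ := hdvd
    have hez : (h : ℤ) = c * e := by exact_mod_cast he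
    have hw : ∀ j : ℤ, rowDet u ((e : ℤ) • w + j • u₀) = h := by
      intro j
      simp only [rowDet, hu1, hu2] at hdet ⊢
      simp only [Prod.snd_add, Prod.smul_snd, Prod.fst_add, Prod.smul_fst, smul_eq_mul]
      rw [hez]; linear_combination (c * e) * hdet
    choose I hI hIu hIv using fun j : ℕ => exists_latMem hh (hw j)
    have hprim : ∀ j : ℕ, LatPrim h (I j) u := fun j =>
      (LatMem.prim (hI j) (hIu j) (hIv j) (hw j)).1
    rw [← Finset.card_range c]
    symm
    refine Finset.card_bij (fun j _ => I j) (fun j _ => by simp [hI, hprim]) ?_ ?_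
    · intro j hj j' hj' hjj
      obtain ⟨a1, a2, a3, -⟩ := latticeIndex_spec_int (hI j)
      have hmem := hIv j'
      rw [← hjj] at hmem
      have hsub := HermiteMem.add_zsmul (hIv j) hmem (-1)
      have heq : ((e : ℤ) • w + (j : ℤ) • u₀) + (-1 : ℤ) • ((e : ℤ) • w + (j' : ℤ) • u₀)
          = ((j : ℤ) - j') • u₀ := by module
      rw [heq] at hsub
      obtain ⟨n, hn⟩ := (hprim j).exists_eq_zsmul a1.ne' a2.ne' hsub (by
        simp only [rowDet, hu1, hu2, Prod.smul_fst, Prod.smul_snd, smul_eq_mul]; ring)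
      rw [hu₀, ← mul_smul] at hn
      have hu₀0 : u₀ ≠ 0 := by
        rintro rfl; simp [rowDet] at hdet
      have hjn := smul_left_injective ℤ hu₀0 hn
      have hlt : |(j : ℤ) - j'| < c := by
        simp only [Finset.mem_range] at hj hj'
        rw [abs_lt]; constructor <;> omega
      have := Int.eq_zero_of_abs_lt_dvd (Dvd.intro_left n hjn.symm) hlt
      omega
    · intro i hi
      simp only [Finset.mem_filter] at hi
      obtain ⟨a1, a2, a3, -⟩ := latticeIndex_spec_int hi.1
      obtain ⟨v, hv, hvd⟩ := hi.2.exists_rowDet_eq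
      rw [a3] at hvd
      obtain ⟨m, hm⟩ := key (v - (e : ℤ) • w) (by
        have := hw 0
        simp only [zero_smul, add_zero] at this
        simp only [rowDet, Prod.fst_sub, Prod.snd_sub] at *; linarith)
      have hcpos : (0 : ℤ) < c := by exact_mod_cast hc
      obtain ⟨j, hj⟩ := Int.eq_ofNat_of_zero_le (Int.emod_nonneg m hcz)
      have hjc : j < c := by
        have := Int.emod_lt_of_pos m hcpos
        rw [hj] at this; exact_mod_cast this
      refine ⟨j, Finset.mem_range.2 hjc, ?_⟩
      refine latMem_unique (hw j) (hI j) hi.1 (hIu j) (hIv j) hi.2.mem ?_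
      have h1 : (e : ℤ) • w + (j : ℤ) • u₀ = v + (-(m / c)) • u := by
        have h2 : (j : ℤ) = m - c * (m / c) := by
          have := Int.emod_add_mul_ediv m c
          rw [hj] at this; linarith
        have h3 : v = (e : ℤ) • w + m • u₀ := by rw [← hm]; abel
        rw [h2, h3, hu₀]; module
      rw [h1]
      exact HermiteMem.add_zsmul hv hi.2.mem _
  · rw [Finset.card_eq_zero, Finset.filter_eq_empty_iff]
    intro i hi hprim
    obtain ⟨a1, a2, a3, -⟩ := latticeIndex_spec_int hi
    obtain ⟨v, -, hvd⟩ := HermitePrim.exists_rowDet_eq hprim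
    apply hdvd
    rw [a3] at hvd
    have : (c : ℤ) ∣ h := by
      rw [← hvd]
      exact ⟨rowDet u₀ v, by simp only [rowDet, hu1, hu2]; ring⟩
    exact_mod_cast this

/-! ### Bases of a lattice inside a box -/

/-- The pairs of vectors of the box `[-N, N]²` with determinant `h`. -/
noncomputable def detPairs (h N : ℕ) : Finset ((ℤ × ℤ) × (ℤ × ℤ)) :=
  (box N ×ˢ box N).filter fun p => rowDet p.1 p.2 = h

theorem mem_detPairs {h N : ℕ} {p : (ℤ × ℤ) × (ℤ × ℤ)} :
    p ∈ detPairs h N ↔ p.1 ∈ box N ∧ p.2 ∈ box N ∧ rowDet p.1 p.2 = h := by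
  simp [detPairs, and_assoc]

theorem detCount_eq_card_detPairs (h N : ℕ) : detCount h N = (detPairs h N).card := by
  unfold detCount
  refine Finset.card_bij (fun x _ => ((x 0, x 1), (x 2, x 3))) ?_ ?_ ?_
  · intro x hx
    simp only [detSolutions, Finset.mem_filter, Fintype.mem_piFinset, Finset.mem_Icc] at hx
    simp only [mem_detPairs, mem_box, abs_le, rowDet]
    exact ⟨⟨hx.1 0, hx.1 1⟩, ⟨hx.1 2, hx.1 3⟩, hx.2⟩
  · intro x _ y _ hxy
    simp only [Prod.mk.injEq] at hxy
    obtain ⟨⟨h0, h1⟩, h2, h3⟩ := hxy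
    funext i
    fin_cases i <;> assumption
  · rintro ⟨⟨a, b⟩, c, d⟩ hp
    simp only [mem_detPairs, mem_box, abs_le, rowDet] at hp
    refine ⟨![a, b, c, d], ?_, by simp⟩
    simp only [detSolutions, Finset.mem_filter, Fintype.mem_piFinset, Finset.mem_Icc]
    refine ⟨fun i => ?_, by simpa using hp.2.2⟩
    fin_cases i
    · exact hp.1.1
    · exact hp.1.2
    · exact hp.2.1.1
    · exact hp.2.1.2

theorem abs_rowDet_le {N : ℕ} {u v : ℤ × ℤ} (hu : u ∈ box N) (hv : v ∈ box N) :
    |rowDet u v| ≤ 2 * (N : ℤ) ^ 2 := by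
  rw [mem_box] at hu hv
  have h1 : |u.1 * v.2| ≤ (N : ℤ) * N := by
    rw [abs_mul]; exact mul_le_mul hu.1 hv.2 (abs_nonneg _) (by positivity)
  have h2 : |u.2 * v.1| ≤ (N : ℤ) * N := by
    rw [abs_mul]; exact mul_le_mul hu.2 hv.1 (abs_nonneg _) (by positivity)
  have := abs_sub (u.1 * v.2) (u.2 * v.1)
  simp only [rowDet]
  linarith

open Classical in
/-- The primitive vectors, within the box `[-N, N]²`, of the lattice of index `h` encoded
by `i`. -/
noncomputable def primsInBox (h N : ℕ) (i : Σ _ : ℕ, ℕ) : Finset (ℤ × ℤ) :=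
  (box N).filter fun u => LatPrim h i u

theorem mem_primsInBox {h N : ℕ} {i : Σ _ : ℕ, ℕ} {u : ℤ × ℤ} :
    u ∈ primsInBox h N i ↔ u ∈ box N ∧ LatPrim h i u := by
  simp [primsInBox]

theorem rowDet_cases {h N : ℕ} (hN : N ^ 2 < h) {i : Σ _ : ℕ, ℕ} (hi : i ∈ latticeIndex h)
    {u v : ℤ × ℤ} (hu : u ∈ primsInBox h N i) (hv : v ∈ primsInBox h N i) :
    v = u ∨ v = -u ∨ rowDet u v = h ∨ rowDet u v = -h := by
  obtain ⟨a1, a2, a3, -⟩ := latticeIndex_spec_int hi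
  rw [mem_primsInBox] at hu hv
  obtain ⟨m, hm⟩ := HermiteMem.dvd_rowDet hu.2.mem hv.2.mem
  rw [a3] at hm
  have hle := abs_rowDet_le hu.1 hv.1
  have hN' : (N : ℤ) ^ 2 < h := by exact_mod_cast hN
  have hh : (0 : ℤ) < h := by nlinarith
  have hm2 : |m| < 2 := by
    rw [hm, abs_mul, abs_of_pos hh] at hle
    by_contra! h2
    nlinarith
  rw [abs_lt] at hm2
  have : m = -1 ∨ m = 0 ∨ m = 1 := by omega
  rcases this with rfl | rfl | rfl
  · right; right; right; linarith
  · rcases hu.2.eq_or_eq_neg a1.ne' a2.ne' hv.2 (by simpa using hm) with h | h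
    · exact Or.inl h
    · exact Or.inr (Or.inl h)
  · right; right; left; linarith

/-- A box with `N² < h` holds at most one primitive vector completing `u` to a positively
oriented basis of a lattice of index `h`: a second one would differ by `± u`, against
`rowDet_le_sq`. -/
theorem rowDet_eq_unique {h N : ℕ} (hN : N ^ 2 < h) {i : Σ _ : ℕ, ℕ} (hi : i ∈ latticeIndex h)
    {u v w : ℤ × ℤ} (hu : u ∈ primsInBox h N i) (hv : v ∈ primsInBox h N i)
    (hw : w ∈ primsInBox h N i) (huv : rowDet u v = h) (huw : rowDet u w = h) : v = w := by
  have hN' : (N : ℤ) ^ 2 < h := by exact_mod_cast hN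
  obtain ⟨a1, a2, a3, -⟩ := latticeIndex_spec_int hi
  have hvw := rowDet_cases hN hi hv hw
  rw [mem_primsInBox] at hu hv hw
  obtain ⟨n, hn⟩ := hu.2.exists_eq_zsmul a1.ne' a2.ne'
    (HermiteMem.add_zsmul hw.2.mem hv.2.mem (-1)) (by
      simp only [rowDet, Prod.fst_add, Prod.snd_add, Prod.smul_fst, Prod.smul_snd,
        smul_eq_mul] at *
      linarith)
  have hwn : w = v + n • u := by rw [← hn]; module
  have hdet : rowDet v w = -n * h := by
    rw [hwn, ← huv]; simp [rowDet]; ring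
  have hh : (0 : ℤ) < h := by nlinarith
  rw [mem_box] at hu hv hw
  rcases hvw with e | e | e | e
  · exact e.symm
  · exfalso
    rw [e] at huw
    simp only [rowDet, Prod.fst_neg, Prod.snd_neg] at huw huv
    linarith
  · exfalso
    rw [hdet] at e
    have : n = -1 := by
      have : -n = 1 := mul_right_cancel₀ hh.ne' (by linarith)
      omega
    subst this
    have h1 : w.1 + u.1 = v.1 := by rw [hwn]; simp
    have h2 : w.2 + u.2 = v.2 := by rw [hwn]; simp
    have := rowDet_le_sq hu.1.1 hu.1.2 hw.1.1 hw.1.2 (by rw [add_comm, h1]; exact hv.1.1)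
      (by rw [add_comm, h2]; exact hv.1.2)
    linarith
  · exfalso
    rw [hdet] at e
    have : n = 1 := mul_right_cancel₀ hh.ne' (by linarith)
    subst this
    have h1 : v.1 + u.1 = w.1 := by rw [hwn]; simp
    have h2 : v.2 + u.2 = w.2 := by rw [hwn]; simp
    have := rowDet_le_sq hu.1.1 hu.1.2 hv.1.1 hv.1.2 (by rw [add_comm, h1]; exact hw.1.1)
      (by rw [add_comm, h2]; exact hw.1.2)
    linarith

theorem neg_mem_primsInBox {h N : ℕ} {i : Σ _ : ℕ, ℕ} {u : ℤ × ℤ}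
    (hu : u ∈ primsInBox h N i) : -u ∈ primsInBox h N i := by
  rw [mem_primsInBox] at *
  exact ⟨neg_mem_box hu.1, hu.2.neg⟩

/-- For `N² < h` a lattice of index `h` has 0, 2 or 4 primitive vectors in the box, hence 0, 0 or
4 positively oriented bases; this is the exact relation between the two counts. -/
theorem card_bases_add_four {h N : ℕ} (hN : N ^ 2 < h) {i : Σ _ : ℕ, ℕ}
    (hi : i ∈ latticeIndex h) :
    ((primsInBox h N i ×ˢ primsInBox h N i).filter fun p => rowDet p.1 p.2 = h).card + 4 =
      2 * (primsInBox h N i).card + if primsInBox h N i = ∅ then 4 else 0 := by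
  classical
  have hhN : h ≠ 0 := by omega
  have hh : (h : ℤ) ≠ 0 := by exact_mod_cast hhN
  have hneg : (-(h : ℤ)) ≠ h := by omega
  obtain ⟨a1, a2, a3, -⟩ := latticeIndex_spec_int hi
  set V := primsInBox h N i with hV
  rcases V.eq_empty_or_nonempty with h0 | ⟨u, hu⟩
  · simp [h0]
  rw [if_neg (Finset.ne_empty_of_mem hu)]
  have hnegne : ∀ x ∈ V, -x ≠ x := by
    intro x hx hxx
    have := HermitePrim.ne_zero a1.ne' a2.ne' (mem_primsInBox.1 hx).2
    exact this (self_eq_neg.1 hxx.symm)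
  have hself : ∀ x : ℤ × ℤ, rowDet x x = 0 := fun x => by simp only [rowDet]; ring
  have hnegr : ∀ x y : ℤ × ℤ, rowDet x (-y) = -rowDet x y := fun x y => by
    simp only [rowDet, Prod.fst_neg, Prod.snd_neg]; ring
  have hnegl : ∀ x y : ℤ × ℤ, rowDet (-x) y = -rowDet x y := fun x y => by
    simp only [rowDet, Prod.fst_neg, Prod.snd_neg]; ring
  have hswap : ∀ x y : ℤ × ℤ, rowDet y x = -rowDet x y := fun x y => by
    simp only [rowDet]; ring
  have hsum : ((V ×ˢ V).filter fun p => rowDet p.1 p.2 = h).card =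
      ∑ x ∈ V, ∑ y ∈ V, if rowDet x y = h then 1 else 0 := by
    rw [Finset.card_filter, Finset.sum_product]
  rw [hsum]
  by_cases hex : ∃ v ∈ V, rowDet u v = h
  · obtain ⟨v, hv, huv⟩ := hex
    have hVeq : V = {u, -u, v, -v} := by
      ext w
      simp only [Finset.mem_insert, Finset.mem_singleton]
      constructor
      · intro hw
        rcases rowDet_cases hN hi hu hw with e | e | e | e
        · exact Or.inl e
        · exact Or.inr (Or.inl e)
        · exact Or.inr (Or.inr (Or.inl (rowDet_eq_unique hN hi hu hw hv e huv)))
        · refine Or.inr (Or.inr (Or.inr ?_))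
          rw [← rowDet_eq_unique hN hi hu (neg_mem_primsInBox hw) hv
            (by rw [hnegr, e, neg_neg]) huv, neg_neg]
      · rintro (rfl | rfl | rfl | rfl)
        · exact hu
        · exact neg_mem_primsInBox hu
        · exact hv
        · exact neg_mem_primsInBox hv
    have n1 : u ≠ -u := (hnegne u hu).symm
    have n2 : u ≠ v := by rintro rfl; rw [hself] at huv; exact hh huv.symm
    have n3 : u ≠ -v := by rintro rfl; rw [hnegl, hself] at huv; exact hh (by simpa using huv.symm)
    have n4 : -u ≠ v := by rintro rfl; rw [hnegr, hself] at huv; exact hh (by simpa using huv.symm)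
    have n5 : -u ≠ -v := fun e => n2 (neg_injective e)
    have n6 : v ≠ -v := (hnegne v hv).symm
    rw [hVeq]
    have m1 : u ∉ ({-u, v, -v} : Finset (ℤ × ℤ)) := by simp [n1, n2, n3]
    have m2 : -u ∉ ({v, -v} : Finset (ℤ × ℤ)) := by simp [n4, n2]
    have m3 : v ∉ ({-v} : Finset (ℤ × ℤ)) := by simpa using n6
    simp only [Finset.sum_insert m1, Finset.sum_insert m2, Finset.sum_insert m3,
      Finset.sum_singleton, Finset.card_insert_of_notMem m1, Finset.card_insert_of_notMem m2,
      Finset.card_insert_of_notMem m3, Finset.card_singleton]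
    simp [hnegr, hnegl, hself, huv, hswap u v, hh.symm, hneg]
  · have hVeq : V = {u, -u} := by
      ext w
      simp only [Finset.mem_insert, Finset.mem_singleton]
      constructor
      · intro hw
        rcases rowDet_cases hN hi hu hw with e | e | e | e
        · exact Or.inl e
        · exact Or.inr e
        · exact absurd ⟨w, hw, e⟩ hex
        · exact absurd ⟨-w, neg_mem_primsInBox hw, by rw [hnegr, e, neg_neg]⟩ hex
      · rintro (rfl | rfl)
        · exact hu
        · exact neg_mem_primsInBox hu
    have n1 : u ≠ -u := (hnegne u hu).symm
    rw [hVeq, Finset.card_pair n1]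
    simp only [Finset.sum_pair n1]
    simp [hnegr, hnegl, hself, hh.symm]

theorem card_detPairs_eq_sum {h : ℕ} (hh : 0 < h) (N : ℕ) : (detPairs h N).card =
    ∑ i ∈ latticeIndex h,
      ((primsInBox h N i ×ˢ primsInBox h N i).filter fun p => rowDet p.1 p.2 = h).card := by
  classical
  rw [← Finset.card_biUnion]
  · congr 1
    ext p
    simp only [mem_detPairs, Finset.mem_biUnion, Finset.mem_filter, Finset.mem_product,
      mem_primsInBox]
    constructor
    · rintro ⟨h1, h2, h3⟩
      obtain ⟨i, hi, hu, hv⟩ := exists_latMem hh h3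
      obtain ⟨hpu, hpv⟩ := LatMem.prim hi hu hv h3
      exact ⟨i, hi, ⟨⟨h1, hpu⟩, h2, hpv⟩, h3⟩
    · rintro ⟨i, hi, ⟨⟨h1, -⟩, h2, -⟩, h3⟩
      exact ⟨h1, h2, h3⟩
  · intro i hi j hj hij
    rw [Function.onFun, Finset.disjoint_left]
    intro p hp hp'
    simp only [Finset.mem_filter, Finset.mem_product, mem_primsInBox] at hp hp'
    exact hij (latMem_unique hp.2 hi hj hp.1.1.2.mem hp.1.2.2.mem hp'.1.1.2.mem hp'.1.2.2.mem)

theorem detCount_add_four_mul {h N : ℕ} (hN : N ^ 2 < h) :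
    detCount h N + 4 * ∑ d ∈ h.divisors, d =
      2 * ∑ i ∈ latticeIndex h, (primsInBox h N i).card +
        4 * ((latticeIndex h).filter fun i => primsInBox h N i = ∅).card := by
  rw [detCount_eq_card_detPairs, card_detPairs_eq_sum (by omega), ← card_latticeIndex,
    Finset.card_filter, Finset.card_eq_sum_ones, Finset.mul_sum, Finset.mul_sum, Finset.mul_sum,
    ← Finset.sum_add_distrib, ← Finset.sum_add_distrib]
  refine Finset.sum_congr rfl fun i hi => ?_
  have := card_bases_add_four hN hi
  rw [mul_one, this]
  split_ifs <;> simp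

/-! ### Counting lattices by their primitive vectors -/

/-- The number of vectors of the box `[-K, K]²` with coprime coordinates. -/
noncomputable def coprimeCount (K : ℕ) : ℕ :=
  ((box K).filter fun u => Int.gcd u.1 u.2 = 1).card

theorem abs_mul_le_iff {g N : ℕ} (hg : 0 < g) (x : ℤ) :
    |(g : ℤ) * x| ≤ N ↔ |x| ≤ (N / g : ℕ) := by
  have hgz : (0 : ℤ) < g := by exact_mod_cast hg
  rw [abs_mul, abs_of_pos hgz, Int.natCast_ediv, Int.le_ediv_iff_mul_le hgz, mul_comm]

theorem card_box_filter_gcd_eq (N : ℕ) {g : ℕ} (hg : 0 < g) :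
    ((box N).filter fun u => Int.gcd u.1 u.2 = g).card = coprimeCount (N / g) := by
  symm
  have hgz : (0 : ℤ) < g := by exact_mod_cast hg
  refine Finset.card_bij (fun u _ => ((g : ℤ) * u.1, (g : ℤ) * u.2)) ?_ ?_ ?_
  · intro u hu
    simp only [Finset.mem_filter, mem_box, abs_mul_le_iff hg, Int.gcd_mul_left] at hu ⊢
    exact ⟨hu.1, by simp [hu.2]⟩
  · intro u _ v _ huv
    simp only [Prod.mk.injEq, mul_eq_mul_left_iff, hgz.ne', or_false] at huv
    exact Prod.ext huv.1 huv.2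
  · rintro ⟨a, b⟩ hu
    simp only [Finset.mem_filter, mem_box] at hu
    obtain ⟨x, rfl⟩ : (g : ℤ) ∣ a := hu.2 ▸ Int.gcd_dvd_left ..
    obtain ⟨y, rfl⟩ : (g : ℤ) ∣ b := hu.2 ▸ Int.gcd_dvd_right ..
    refine ⟨(x, y), ?_, rfl⟩
    simp only [Finset.mem_filter, mem_box, abs_mul_le_iff hg, Int.gcd_mul_left,
      Int.natAbs_natCast] at hu ⊢
    exact ⟨hu.1, Nat.eq_of_mul_eq_mul_left hg (by rw [hu.2, mul_one])⟩

open Classical in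
/-- Double count of the pairs of a lattice of index `h` and a primitive vector of it in the finite
set `S` of nonzero vectors. -/
theorem sum_card_filter_latPrim {h : ℕ} (hh : 0 < h) (S : Finset (ℤ × ℤ)) (hS : 0 ∉ S) :
    ∑ i ∈ latticeIndex h, (S.filter fun u => LatPrim h i u).card =
      ∑ u ∈ S, if Int.gcd u.1 u.2 ∣ h then Int.gcd u.1 u.2 else 0 := by
  simp only [Finset.card_filter]
  rw [Finset.sum_comm]
  refine Finset.sum_congr rfl fun u hu => ?_
  rw [← card_filter_latPrim hh (fun h0 => hS (h0 ▸ hu)), Finset.card_filter]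

theorem sum_card_primsInBox {h : ℕ} (hh : 0 < h) (N : ℕ) :
    ∑ i ∈ latticeIndex h, (primsInBox h N i).card =
      ∑ g ∈ h.divisors, g * coprimeCount (N / g) := by
  classical
  have h1 : ∀ i ∈ latticeIndex h, (primsInBox h N i).card =
      (((box N).erase 0).filter fun u => LatPrim h i u).card := by
    intro i hi
    obtain ⟨a1, a2, -, -⟩ := latticeIndex_spec_int hi
    congr 1
    ext u
    simp only [mem_primsInBox, Finset.mem_filter, Finset.mem_erase]
    exact ⟨fun hu => ⟨⟨HermitePrim.ne_zero a1.ne' a2.ne' hu.2, hu.1⟩, hu.2⟩,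
      fun hu => ⟨hu.1.2, hu.2⟩⟩
  rw [Finset.sum_congr rfl h1, sum_card_filter_latPrim hh _ (by simp)]
  have h2 : ∀ g ∈ h.divisors, g * coprimeCount (N / g) =
      ∑ u ∈ (box N).erase 0, if Int.gcd u.1 u.2 = g then g else 0 := by
    intro g hg
    have hg0 := Nat.pos_of_mem_divisors hg
    rw [← card_box_filter_gcd_eq N hg0, Finset.card_filter, Finset.mul_sum,
      Finset.sum_erase (box N) (by simp [hg0.ne])]
    simp
  rw [Finset.sum_congr rfl h2, Finset.sum_comm]
  refine Finset.sum_congr rfl fun u _ => ?_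
  rw [Finset.sum_ite_eq]
  simp [hh.ne']

/-- The boundary of the box `[-B, B]²`. -/
noncomputable def boxShell (B : ℕ) : Finset (ℤ × ℤ) :=
  (box B).filter fun u => |u.1| = B ∨ |u.2| = B

/-- For `h ≤ B²` every lattice of index `h` has a primitive vector in the box of radius `B`, so
those with none in the next smaller box are counted by vectors on the boundary. -/
theorem card_filter_primsInBox_eq_empty_le {h N : ℕ} (hh : 0 < h) (hN : h ≤ (N + 1) ^ 2) :
    ((latticeIndex h).filter fun i => primsInBox h N i = ∅).card ≤
      ∑ u ∈ boxShell (N + 1), Int.gcd u.1 u.2 := by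
  classical
  have h0 : (0 : ℤ × ℤ) ∉ boxShell (N + 1) := by
    simp only [boxShell, Finset.mem_filter, not_and, not_or]
    intro _
    simp only [Prod.fst_zero, Prod.snd_zero, abs_zero]
    constructor <;> · push_cast; omega
  calc _ ≤ ∑ i ∈ latticeIndex h, ((boxShell (N + 1)).filter fun u => LatPrim h i u).card := by
        rw [Finset.card_filter]
        refine Finset.sum_le_sum fun i hi => ?_
        split_ifs with hV
        · obtain ⟨a1, a2, a3, -⟩ := latticeIndex_spec hi
          obtain ⟨u, hu, hu1, hu2⟩ := exists_hermitePrim (r := i.2) a1 a2 (a3.trans_le hN)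
          rw [Nat.one_le_iff_ne_zero, ← Nat.pos_iff_ne_zero, Finset.card_pos]
          refine ⟨u, ?_⟩
          have hnot : u ∉ box N := fun hb => by
            have : u ∈ primsInBox h N i := mem_primsInBox.2 ⟨hb, hu⟩
            rw [hV] at this; simp at this
          rw [mem_box] at hnot
          simp only [boxShell, Finset.mem_filter, mem_box]
          push_cast at hu1 hu2 ⊢
          exact ⟨⟨⟨hu1, hu2⟩, by omega⟩, hu⟩
        · exact Nat.zero_le _
    _ = _ := sum_card_filter_latPrim hh _ h0
    _ ≤ _ := by
        refine Finset.sum_le_sum fun u _ => ?_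
        split_ifs
        · exact le_rfl
        · exact Nat.zero_le _

/-! ### Sums of greatest common divisors over the boundary of a box -/

theorem card_Icc_filter_dvd (K : ℕ) {d : ℕ} (hd : 0 < d) :
    ((Finset.Icc (-(K : ℤ)) K).filter fun y => (d : ℤ) ∣ y).card = 2 * (K / d) + 1 := by
  have hdz : (d : ℤ) ≠ 0 := by exact_mod_cast hd.ne'
  have h1 : (Finset.Icc (-((K / d : ℕ) : ℤ)) (K / d : ℕ)).card = 2 * (K / d) + 1 := by
    rw [Int.card_Icc]; omega
  rw [← h1]
  symm
  refine Finset.card_bij (fun y _ => (d : ℤ) * y) ?_ ?_ ?_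
  · intro y hy
    rw [Finset.mem_Icc, ← abs_le, ← abs_mul_le_iff hd, abs_le, ← Finset.mem_Icc] at hy
    exact Finset.mem_filter.2 ⟨hy, dvd_mul_right _ _⟩
  · intro y _ y' _ h
    exact mul_left_cancel₀ hdz h
  · intro y hy
    obtain ⟨hy, x, rfl⟩ := Finset.mem_filter.1 hy
    rw [Finset.mem_Icc, ← abs_le, abs_mul_le_iff hd, abs_le, ← Finset.mem_Icc] at hy
    exact ⟨x, hy, rfl⟩

theorem sum_gcd_Icc_le {B : ℕ} (hB : 0 < B) :
    ∑ y ∈ Finset.Icc (-(B : ℤ)) B, Int.gcd B y ≤ 3 * B * B.divisors.card := by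
  calc ∑ y ∈ Finset.Icc (-(B : ℤ)) B, Int.gcd B y
      ≤ ∑ y ∈ Finset.Icc (-(B : ℤ)) B, ∑ d ∈ B.divisors, if (d : ℤ) ∣ y then d else 0 := by
        refine Finset.sum_le_sum fun y _ => ?_
        have hmem : Int.gcd B y ∈ B.divisors := by
          rw [Nat.mem_divisors]
          exact ⟨by exact_mod_cast Int.gcd_dvd_left (B : ℤ) y, hB.ne'⟩
        refine le_trans ?_ (Finset.single_le_sum (fun _ _ => Nat.zero_le _) hmem)
        rw [if_pos (Int.gcd_dvd_right (B : ℤ) y)]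
    _ = ∑ d ∈ B.divisors, (2 * (B / d) + 1) * d := by
        rw [Finset.sum_comm]
        refine Finset.sum_congr rfl fun d hd => ?_
        rw [← card_Icc_filter_dvd B (Nat.pos_of_mem_divisors hd), ← Finset.sum_filter,
          Finset.sum_const, smul_eq_mul]
    _ ≤ ∑ d ∈ B.divisors, 3 * B := by
        refine Finset.sum_le_sum fun d hd => ?_
        have h1 := Nat.div_mul_cancel (Nat.dvd_of_mem_divisors hd)
        have h2 := Nat.divisor_le hd
        nlinarith
    _ = 3 * B * B.divisors.card := by rw [Finset.sum_const, smul_eq_mul, mul_comm]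

theorem sum_gcd_boxShell_le {B : ℕ} (hB : 0 < B) :
    ∑ u ∈ boxShell B, Int.gcd u.1 u.2 ≤ 12 * B * B.divisors.card := by
  classical
  set E : Finset ℤ := {(B : ℤ), -(B : ℤ)} with hE
  set I : Finset ℤ := Finset.Icc (-(B : ℤ)) B with hI
  have hne : (B : ℤ) ≠ -(B : ℤ) := by omega
  have hsub : boxShell B ⊆ E ×ˢ I ∪ I ×ˢ E := by
    intro u hu
    simp only [boxShell, box, Finset.mem_filter, Finset.mem_product] at hu
    simp only [Finset.mem_union, Finset.mem_product, hE, Finset.mem_insert, Finset.mem_singleton]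
    rcases hu with ⟨⟨h1, h2⟩, h3 | h3⟩
    · exact Or.inl ⟨eq_or_eq_neg_of_abs_eq h3, h2⟩
    · exact Or.inr ⟨h1, eq_or_eq_neg_of_abs_eq h3⟩
  have hEI : ∑ u ∈ E ×ˢ I, Int.gcd u.1 u.2 ≤ 6 * B * B.divisors.card := by
    rw [Finset.sum_product, hE, Finset.sum_pair hne]
    simp only [Int.neg_gcd]
    linarith [sum_gcd_Icc_le hB]
  have hIE : ∑ u ∈ I ×ˢ E, Int.gcd u.1 u.2 ≤ 6 * B * B.divisors.card := by
    rw [Finset.sum_product_right, hE, Finset.sum_pair hne]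
    simp only [Int.gcd_neg, Int.gcd_comm _ (B : ℤ)]
    linarith [sum_gcd_Icc_le hB]
  have h1 := Finset.sum_le_sum_of_subset (f := fun u : ℤ × ℤ => Int.gcd u.1 u.2) hsub
  calc _ ≤ _ := h1
    _ ≤ ∑ u ∈ E ×ˢ I, Int.gcd u.1 u.2 + ∑ u ∈ I ×ˢ E, Int.gcd u.1 u.2 := by
        rw [← Finset.sum_union_inter]; exact Nat.le_add_right _ _
    _ ≤ 6 * B * B.divisors.card + 6 * B * B.divisors.card := add_le_add hEI hIE
    _ = _ := by ring

/-- The solutions `v` of `det (u, v) = c` are spaced by `u / gcd u`, so a box with `u` on its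
boundary holds `O(gcd u)` of them. -/
theorem card_filter_rowDet_le {B : ℕ} (hB : 0 < B) {u : ℤ × ℤ} (hu : u ∈ boxShell B) (c : ℤ) :
    ((box B).filter fun v => rowDet u v = c).card ≤ 5 * Int.gcd u.1 u.2 := by
  classical
  have hu0 : u ≠ 0 := by
    rintro rfl
    simp only [boxShell, Finset.mem_filter, Prod.fst_zero, Prod.snd_zero, abs_zero] at hu
    omega
  obtain ⟨u₀, w, hu₀, hdet⟩ := exists_bezout hu0
  have hg : 0 < Int.gcd u.1 u.2 := Nat.pos_of_ne_zero fun h0 => hu0 (by rw [hu₀, h0]; simp)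
  set g := Int.gcd u.1 u.2
  have hgz : (0 : ℤ) < g := by exact_mod_cast hg
  have hBz : (0 : ℤ) < B := by exact_mod_cast hB
  have hu1 : u.1 = g * u₀.1 := by rw [hu₀]; simp
  have hu2 : u.2 = g * u₀.2 := by rw [hu₀]; simp
  rcases ((box B).filter fun v => rowDet u v = c).eq_empty_or_nonempty with h0 | ⟨v₀, hv₀⟩
  · simp [h0]
  simp only [Finset.mem_filter, mem_box] at hv₀
  have hsub : ((box B).filter fun v => rowDet u v = c) ⊆
      (Finset.Icc (-(2 * g : ℤ)) (2 * g)).image fun m => v₀ + m • u₀ := by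
    intro v hv
    simp only [Finset.mem_filter, mem_box] at hv
    obtain ⟨m, hm⟩ := exists_eq_zsmul_of_rowDet_eq_zero (z := v - v₀) hdet
      (mul_left_cancel₀ hgz.ne' (by
        have h1 := hv.2.trans hv₀.2.symm
        simp only [rowDet, hu1, hu2, Prod.fst_sub, Prod.snd_sub] at h1 ⊢
        linear_combination h1))
    rw [Finset.mem_image]
    refine ⟨m, ?_, by rw [← hm]; abel⟩
    have hbound : ∀ x y z : ℤ, |x| ≤ B → |y| ≤ B → x - y = m * z → |(g : ℤ) * z| = B →
        |m| ≤ 2 * g := by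
      intro x y z hx hy hxy hz
      have h1 : |m| * B ≤ 2 * g * B := by
        calc |m| * B = g * |x - y| := by rw [← hz, hxy, abs_mul, abs_mul, Nat.abs_cast]; ring
          _ ≤ g * (|x| + |y|) := by gcongr; exact abs_sub _ _
          _ ≤ g * (B + B) := by gcongr
          _ = _ := by ring
      exact le_of_mul_le_mul_right h1 hBz
    rw [Finset.mem_Icc, ← abs_le]
    simp only [boxShell, Finset.mem_filter, hu1, hu2] at hu
    rcases hu.2 with h1 | h1
    · exact hbound v.1 v₀.1 u₀.1 hv.1.1 hv₀.1.1 (by simpa using congrArg Prod.fst hm) h1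
    · exact hbound v.2 v₀.2 u₀.2 hv.1.2 hv₀.1.2 (by simpa using congrArg Prod.snd hm) h1
  refine (Finset.card_le_card hsub).trans (Finset.card_image_le.trans ?_)
  rw [Int.card_Icc]
  omega

/-! ### Varying the size of the box -/

theorem detCount_mono (h : ℕ) : Monotone (detCount h) := by
  intro a b hab
  rw [detCount_eq_card_detPairs, detCount_eq_card_detPairs]
  refine Finset.card_le_card fun p hp => ?_
  simp only [mem_detPairs, mem_box] at hp ⊢
  have : (a : ℤ) ≤ b := by exact_mod_cast hab
  exact ⟨⟨hp.1.1.trans this, hp.1.2.trans this⟩, ⟨hp.2.1.1.trans this, hp.2.1.2.trans this⟩,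
    hp.2.2⟩

theorem mem_box_or_mem_boxShell {B : ℕ} {u : ℤ × ℤ} (hu : u ∈ box (B + 1)) :
    u ∈ box B ∨ u ∈ boxShell (B + 1) := by
  by_cases h : u ∈ box B
  · exact Or.inl h
  · refine Or.inr ?_
    simp only [boxShell, Finset.mem_filter]
    refine ⟨hu, ?_⟩
    rw [mem_box] at hu h
    push_cast at hu ⊢
    omega

/-- Enlarging the box by one adds few solutions: a new one has `u` or `v` on the boundary. -/
theorem detCount_succ_le (h B : ℕ) :
    detCount h (B + 1) ≤ detCount h B + 120 * (B + 1) * (B + 1).divisors.card := by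
  classical
  have key : ∀ c : ℤ, ((boxShell (B + 1) ×ˢ box (B + 1)).filter
      fun p => rowDet p.1 p.2 = c).card ≤ 60 * (B + 1) * (B + 1).divisors.card := by
    intro c
    rw [Finset.card_filter, Finset.sum_product]
    calc _ ≤ ∑ u ∈ boxShell (B + 1), 5 * Int.gcd u.1 u.2 := by
          refine Finset.sum_le_sum fun u hu => ?_
          rw [← Finset.card_filter]
          exact card_filter_rowDet_le B.succ_pos hu c
      _ ≤ _ := by
          rw [← Finset.mul_sum]
          linarith [sum_gcd_boxShell_le B.succ_pos]
  rw [detCount_eq_card_detPairs, detCount_eq_card_detPairs]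
  set X := (boxShell (B + 1) ×ˢ box (B + 1)).filter fun p => rowDet p.1 p.2 = h
  set Y := (boxShell (B + 1) ×ˢ box (B + 1)).filter fun p => rowDet p.1 p.2 = -h
  have hsub : detPairs h (B + 1) ⊆ detPairs h B ∪ (X ∪ Y.image Prod.swap) := by
    rintro ⟨u, v⟩ hp
    rw [mem_detPairs] at hp
    rw [Finset.mem_union, Finset.mem_union]
    obtain ⟨hu, hv, huv⟩ := hp
    rcases mem_box_or_mem_boxShell hu with hu' | hu'
    · rcases mem_box_or_mem_boxShell hv with hv' | hv'
      · exact Or.inl (mem_detPairs.2 ⟨hu', hv', huv⟩)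
      · refine Or.inr (Or.inr (Finset.mem_image.2 ⟨(v, u), ?_, rfl⟩))
        simp only [Y, Finset.mem_filter, Finset.mem_product]
        exact ⟨⟨hv', hu⟩, by simp only [rowDet] at *; linarith⟩
    · refine Or.inr (Or.inl ?_)
      simp only [X, Finset.mem_filter, Finset.mem_product]
      exact ⟨⟨hu', hv⟩, huv⟩
  have h1 := Finset.card_le_card hsub
  have h2 := Finset.card_union_le (detPairs h B) (X ∪ Y.image Prod.swap)
  have h3 := Finset.card_union_le X (Y.image Prod.swap)
  have h4 : (Y.image Prod.swap).card ≤ Y.card := Finset.card_image_le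
  have h5 := key h
  have h6 := key (-h)
  change X.card ≤ _ at h5
  change Y.card ≤ _ at h6
  linarith

theorem detCount_add_le {h : ℕ} {L T : ℝ} (hL : ∀ B : ℕ, 0 < B → (B : ℝ) ≤ L →
    (B : ℝ) * B.divisors.card ≤ T) (a : ℕ) :
    ∀ k : ℕ, ((a + k : ℕ) : ℝ) ≤ L → (detCount h (a + k) : ℝ) ≤ detCount h a + k * (120 * T)
  | 0, _ => by simp
  | k + 1, hk => by
    have hk' : ((a + k : ℕ) : ℝ) ≤ L := by push_cast at *; linarith
    have h1 := detCount_add_le (h := h) hL a k hk'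
    have h2 : (detCount h (a + k + 1) : ℝ) ≤ detCount h (a + k) +
        120 * ((a + k + 1 : ℕ) * (a + k + 1).divisors.card) := by
      rw [← mul_assoc]
      exact_mod_cast detCount_succ_le h (a + k)
    have h3 := hL (a + k + 1) (Nat.succ_pos _) hk
    rw [← add_assoc]
    push_cast at *
    linarith

theorem abs_detCount_sub_detCount_le {h k M N : ℕ} {L T : ℝ} (hL : ∀ B : ℕ, 0 < B → (B : ℝ) ≤ L →
    (B : ℝ) * B.divisors.card ≤ T) (hT : 0 ≤ T) (hM : (M : ℝ) ≤ L) (hN : (N : ℝ) ≤ L)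
    (h1 : M ≤ N + k) (h2 : N ≤ M + k) :
    |(detCount h N : ℝ) - detCount h M| ≤ k * (120 * T) := by
  rcases le_total M N with hle | hle
  · obtain ⟨j, rfl⟩ := Nat.exists_eq_add_of_le hle
    have h3 : (detCount h M : ℝ) ≤ detCount h (M + j) := by exact_mod_cast detCount_mono h hle
    have h4 := detCount_add_le (h := h) hL M j hN
    have h5 : (j : ℝ) * (120 * T) ≤ k * (120 * T) := by
      gcongr; omega
    rw [abs_of_nonneg (by linarith)]; linarith
  · obtain ⟨j, rfl⟩ := Nat.exists_eq_add_of_le hle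
    have h3 : (detCount h N : ℝ) ≤ detCount h (N + j) := by exact_mod_cast detCount_mono h hle
    have h4 := detCount_add_le (h := h) hL N j hM
    have h5 : (j : ℝ) * (120 * T) ≤ k * (120 * T) := by
      gcongr; omega
    rw [abs_of_nonpos (by linarith)]; linarith

/-! ### Counting coprime vectors -/

/-- Möbius inversion over the gcd; the summand `- 1` removes the zero vector. -/
theorem coprimeCount_eq_sum (K : ℕ) : (coprimeCount K : ℤ) =
    ∑ d ∈ Finset.Icc 1 K, ArithmeticFunction.moebius d * ((2 * (K / d : ℕ) + 1) ^ 2 - 1) := by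
  classical
  have hgcd : ∀ u ∈ (box K).erase 0, 0 < Int.gcd u.1 u.2 ∧ Int.gcd u.1 u.2 ≤ K := by
    intro u hu
    rw [Finset.mem_erase, mem_box] at hu
    have h0 : 0 < Int.gcd u.1 u.2 := by
      refine Nat.pos_of_ne_zero fun h => hu.1 ?_
      obtain ⟨h1, h2⟩ := Int.gcd_eq_zero_iff.1 h
      exact Prod.ext h1 h2
    refine ⟨h0, ?_⟩
    by_cases h1 : u.1 = 0
    · have h2 : u.2 ≠ 0 := fun h2 => hu.1 (Prod.ext h1 h2)
      have := Int.le_of_dvd (abs_pos.2 h2) ((dvd_abs _ _).2 (Int.gcd_dvd_right u.1 u.2))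
      have := this.trans hu.2.2
      exact_mod_cast this
    · have := Int.le_of_dvd (abs_pos.2 h1) ((dvd_abs _ _).2 (Int.gcd_dvd_left u.1 u.2))
      have := this.trans hu.2.1
      exact_mod_cast this
  have h1 : (coprimeCount K : ℤ) =
      ∑ u ∈ (box K).erase 0, ∑ d ∈ (Int.gcd u.1 u.2).divisors, ArithmeticFunction.moebius d := by
    have hmu : ∀ n : ℕ,
        ∑ d ∈ n.divisors, ArithmeticFunction.moebius d = if n = 1 then 1 else 0 := by
      intro n
      rw [← ArithmeticFunction.coe_mul_zeta_apply, ArithmeticFunction.moebius_mul_coe_zeta,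
        ArithmeticFunction.one_apply]
    simp only [hmu]
    rw [Finset.sum_erase (box K) (by simp), coprimeCount, Finset.card_filter]
    push_cast
    rfl
  have h2 : ∀ u ∈ (box K).erase 0,
      ∑ d ∈ (Int.gcd u.1 u.2).divisors, ArithmeticFunction.moebius d =
      ∑ d ∈ Finset.Icc 1 K, if d ∣ Int.gcd u.1 u.2 then ArithmeticFunction.moebius d else 0 := by
    intro u hu
    obtain ⟨hp, hle⟩ := hgcd u hu
    rw [← Finset.sum_filter]
    refine Finset.sum_congr ?_ fun _ _ => rfl
    ext d
    simp only [Nat.mem_divisors, Finset.mem_filter, Finset.mem_Icc]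
    refine ⟨fun hd => ⟨⟨Nat.pos_of_dvd_of_pos hd.1 hp, (Nat.le_of_dvd hp hd.1).trans hle⟩, hd.1⟩,
      fun hd => ⟨hd.2, hp.ne'⟩⟩
  rw [h1, Finset.sum_congr rfl h2, Finset.sum_comm]
  refine Finset.sum_congr rfl fun d hd => ?_
  have hd0 : 0 < d := (Finset.mem_Icc.1 hd).1
  have h3 : ((box K).filter fun u => d ∣ Int.gcd u.1 u.2) =
      ((Finset.Icc (-(K : ℤ)) K).filter fun y => (d : ℤ) ∣ y) ×ˢ
        ((Finset.Icc (-(K : ℤ)) K).filter fun y => (d : ℤ) ∣ y) := by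
    ext u
    simp only [box, Finset.mem_filter, Finset.mem_product, Int.dvd_gcd_iff]
    tauto
  have h4 := congrArg Finset.card h3
  rw [Finset.card_product, card_Icc_filter_dvd K hd0] at h4
  rw [← Finset.sum_filter, Finset.sum_const, Finset.filter_erase, Finset.card_erase_of_mem (by
    simp [mem_box]), h4, nsmul_eq_mul, mul_comm, Nat.cast_sub (Nat.succ_le_of_lt (by positivity))]
  push_cast
  ring

theorem riemannZeta_two_re : (riemannZeta 2).re = Real.pi ^ 2 / 6 := by
  rw [riemannZeta_two]
  norm_cast

theorem inv_riemannZeta_two_re_mem : 0 ≤ ((riemannZeta 2).re)⁻¹ ∧ ((riemannZeta 2).re)⁻¹ ≤ 1 := by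
  rw [riemannZeta_two_re]
  refine ⟨by positivity, inv_le_one_of_one_le₀ ?_⟩
  nlinarith [Real.pi_gt_three]

theorem hasSum_moebius_div_sq :
    HasSum (fun n : ℕ => (ArithmeticFunction.moebius n : ℝ) / (n : ℝ) ^ 2)
      ((riemannZeta 2).re)⁻¹ := by
  have hs : (1 : ℝ) < (2 : ℂ).re := by norm_num
  have h1 := (ArithmeticFunction.LSeriesSummable_moebius_iff.2 hs).LSeriesHasSum
  have h2 := LSeries_one_mul_Lseries_moebius hs
  rw [LSeries_one_eq_riemannZeta hs] at h2
  have h3 : (((riemannZeta 2).re : ℝ) : ℂ) = riemannZeta 2 := by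
    rw [riemannZeta_two_re, riemannZeta_two]; push_cast; rfl
  rw [← Complex.hasSum_ofReal]
  push_cast
  rw [h3, inv_eq_of_mul_eq_one_right h2]
  unfold LSeriesHasSum at h1
  convert h1 using 2 with n
  rcases eq_or_ne n 0 with rfl | hn
  · simp
  · rw [LSeries.term_of_ne_zero hn]
    norm_cast

theorem abs_sum_moebius_sub_le {K : ℕ} (hK : K ≠ 0) :
    |∑ d ∈ Finset.Icc 1 K, (ArithmeticFunction.moebius d : ℝ) / (d : ℝ) ^ 2
      - ((riemannZeta 2).re)⁻¹| ≤ (K : ℝ)⁻¹ := by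
  have h1 := hasSum_moebius_div_sq.tendsto_sum_nat.comp (Filter.tendsto_add_atTop_nat 1)
  have h2 := (h1.const_sub (∑ d ∈ Finset.Icc 1 K,
    (ArithmeticFunction.moebius d : ℝ) / (d : ℝ) ^ 2)).abs
  refine le_of_tendsto h2 ?_
  filter_upwards [Filter.eventually_ge_atTop K] with n hn
  have h3 : ∑ d ∈ Finset.range (n + 1), (ArithmeticFunction.moebius d : ℝ) / (d : ℝ) ^ 2 =
      ∑ d ∈ Finset.Icc 1 K, (ArithmeticFunction.moebius d : ℝ) / (d : ℝ) ^ 2 +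
      ∑ d ∈ Finset.Ioc K n, (ArithmeticFunction.moebius d : ℝ) / (d : ℝ) ^ 2 := by
    rw [← Finset.sum_union]
    · symm
      refine Finset.sum_subset ?_ ?_
      · intro d
        simp only [Finset.mem_union, Finset.mem_Icc, Finset.mem_Ioc, Finset.mem_range]
        omega
      · intro d hd hd'
        simp only [Finset.mem_union, Finset.mem_Icc, Finset.mem_Ioc, Finset.mem_range] at hd hd'
        have : d = 0 := by omega
        simp [this]
    · rw [Finset.disjoint_left]
      intro d
      simp only [Finset.mem_Icc, Finset.mem_Ioc]
      omega
  simp only [Function.comp_apply]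
  rw [h3, sub_add_cancel_left, abs_neg]
  calc _ ≤ ∑ d ∈ Finset.Ioc K n, |(ArithmeticFunction.moebius d : ℝ) / (d : ℝ) ^ 2| :=
        Finset.abs_sum_le_sum_abs _ _
    _ ≤ ∑ d ∈ Finset.Ioc K n, ((d : ℝ) ^ 2)⁻¹ := by
        refine Finset.sum_le_sum fun d _ => ?_
        rw [abs_div, abs_of_nonneg (by positivity : (0 : ℝ) ≤ (d : ℝ) ^ 2), div_eq_mul_inv]
        have : |(ArithmeticFunction.moebius d : ℝ)| ≤ 1 := by
          exact_mod_cast ArithmeticFunction.abs_moebius_le_one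
        exact mul_le_of_le_one_left (by positivity) this
    _ ≤ (K : ℝ)⁻¹ - (n : ℝ)⁻¹ := sum_Ioc_inv_sq_le_sub hK hn
    _ ≤ (K : ℝ)⁻¹ := by
        have : (0 : ℝ) ≤ (n : ℝ)⁻¹ := by positivity
        linarith

theorem sum_Icc_inv_le (K : ℕ) : ∑ d ∈ Finset.Icc 1 K, (d : ℝ)⁻¹ ≤ 1 + Real.log K := by
  have h := harmonic_le_one_add_log K
  rw [harmonic_eq_sum_Icc] at h
  push_cast at h
  exact h

theorem abs_coprimeCount_sub_le (K : ℕ) :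
    |(coprimeCount K : ℝ) - 4 * ((riemannZeta 2).re)⁻¹ * (K : ℝ) ^ 2| ≤
      8 * K * (1 + Real.log K) := by
  rcases eq_or_ne K 0 with rfl | hK
  · have := coprimeCount_eq_sum 0
    simp at this
    simp [this]
  have hK1 : (1 : ℝ) ≤ K := by exact_mod_cast Nat.one_le_iff_ne_zero.2 hK
  set z := ((riemannZeta 2).re)⁻¹ with hz
  set m := ∑ d ∈ Finset.Icc 1 K, (ArithmeticFunction.moebius d : ℝ) / (d : ℝ) ^ 2 with hm
  have hR : (coprimeCount K : ℝ) = ∑ d ∈ Finset.Icc 1 K,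
      (ArithmeticFunction.moebius d : ℝ) * ((2 * (K / d : ℕ) + 1) ^ 2 - 1) := by
    exact_mod_cast coprimeCount_eq_sum K
  have h1 : |(coprimeCount K : ℝ) - 4 * (K : ℝ) ^ 2 * m| ≤ 4 * K * (1 + Real.log K) := by
    rw [hR, hm, Finset.mul_sum, ← Finset.sum_sub_distrib]
    refine (Finset.abs_sum_le_sum_abs _ _).trans ?_
    calc _ ≤ ∑ d ∈ Finset.Icc 1 K, 4 * (K : ℝ) * (d : ℝ)⁻¹ := by
          refine Finset.sum_le_sum fun d hd => ?_
          have hd1 : (0 : ℝ) < d := by exact_mod_cast (Finset.mem_Icc.1 hd).1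
          have hq1 : ((K / d : ℕ) : ℝ) ≤ K / d := Nat.cast_div_le
          have hq2 : (K : ℝ) / d < (K / d : ℕ) + 1 := by
            rw [div_lt_iff₀ hd1]
            have : (K : ℝ) < (K / d : ℕ) * d + d := by
              exact_mod_cast Nat.lt_div_mul_add (Finset.mem_Icc.1 hd).1 (a := K)
            linarith
          have hq0 : (0 : ℝ) ≤ (K / d : ℕ) := Nat.cast_nonneg _
          set q : ℝ := ((K / d : ℕ) : ℝ)
          have hx : (K : ℝ) ^ 2 * ((ArithmeticFunction.moebius d : ℝ) / (d : ℝ) ^ 2) =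
            (ArithmeticFunction.moebius d : ℝ) * (K / d) ^ 2 := by field_simp
          have hmu : |(ArithmeticFunction.moebius d : ℝ)| ≤ 1 := by
            exact_mod_cast ArithmeticFunction.abs_moebius_le_one
          rw [mul_assoc 4, hx, mul_assoc 4, ← div_eq_mul_inv]
          set x : ℝ := (K : ℝ) / d
          have hx0 : 0 ≤ x := hq0.trans hq1
          calc _ = |(ArithmeticFunction.moebius d : ℝ)| * |4 * (q * (q + 1) - x ^ 2)| := by
                rw [← abs_mul]; congr 1; ring
            _ ≤ 1 * (4 * x) := by
                refine mul_le_mul hmu ?_ (abs_nonneg _) zero_le_one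
                rw [abs_le]; constructor <;> nlinarith
            _ = 4 * x := one_mul _
      _ = 4 * K * ∑ d ∈ Finset.Icc 1 K, (d : ℝ)⁻¹ := by rw [Finset.mul_sum]
      _ ≤ _ := by gcongr; exact sum_Icc_inv_le K
  have h2 : |4 * (K : ℝ) ^ 2 * m - 4 * z * (K : ℝ) ^ 2| ≤ 4 * (K : ℝ) := by
    calc _ = 4 * (K : ℝ) ^ 2 * |m - z| := by
          have h0 : (0 : ℝ) ≤ 4 * (K : ℝ) ^ 2 := by positivity
          rw [← abs_of_nonneg h0, ← abs_mul, abs_of_nonneg h0, mul_sub]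
          congr 2; ring
      _ ≤ 4 * (K : ℝ) ^ 2 * (K : ℝ)⁻¹ := by gcongr; exact abs_sum_moebius_sub_le hK
      _ = 4 * K := by field_simp
  have hlog : 0 ≤ Real.log K := Real.log_nonneg hK1
  calc _ ≤ |(coprimeCount K : ℝ) - 4 * (K : ℝ) ^ 2 * m| +
        |4 * (K : ℝ) ^ 2 * m - 4 * z * (K : ℝ) ^ 2| := abs_sub_le _ _ _
    _ ≤ _ := by nlinarith

/-! ### The divisor bound -/

/-- The divisor bound `τ(n) ≪ n ^ δ`. -/
theorem exists_card_divisors_le {δ : ℝ} (hδ : 0 < δ) :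
    ∃ C : ℝ, 0 < C ∧ ∀ n : ℕ, n ≠ 0 → (n.divisors.card : ℝ) ≤ C * (n : ℝ) ^ δ := by
  obtain ⟨P, hP⟩ := exists_nat_ge ((2 : ℝ) ^ (1 / δ))
  have hl : 0 < δ * Real.log 2 := mul_pos hδ (Real.log_pos (by norm_num))
  set c : ℝ := 1 + 1 / (δ * Real.log 2) with hc
  have hc1 : 1 ≤ c := by rw [hc]; have := one_div_pos.2 hl; linarith
  have hc0 : 0 < c := by linarith
  refine ⟨c ^ P, by positivity, fun n hn => ?_⟩
  -- only the primes below `2 ^ (1 / δ)` contribute a factor larger than `1`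
  have hfac : ∀ p ∈ n.primeFactors, ((n.factorization p + 1 : ℕ) : ℝ) ≤
      (if p < P then c else 1) * ((p : ℝ) ^ n.factorization p) ^ δ := by
    intro p hp
    set e := n.factorization p
    have hp2 : (2 : ℝ) ≤ p := by exact_mod_cast (Nat.prime_of_mem_primeFactors hp).two_le
    have hp0 : (0 : ℝ) < p := by linarith
    have hpow : ((p : ℝ) ^ e) ^ δ = ((p : ℝ) ^ δ) ^ e := by
      rw [← Real.rpow_natCast, ← Real.rpow_natCast, ← Real.rpow_mul hp0.le, ← Real.rpow_mul hp0.le,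
        mul_comm]
    rw [hpow]
    split_ifs with hlt
    · have h1 : 1 + δ * Real.log 2 ≤ (p : ℝ) ^ δ := by
        calc 1 + δ * Real.log 2 ≤ Real.exp (δ * Real.log 2) := by
              rw [add_comm]; exact Real.add_one_le_exp _
          _ = (2 : ℝ) ^ δ := by rw [Real.rpow_def_of_pos (by norm_num), mul_comm]
          _ ≤ (p : ℝ) ^ δ := Real.rpow_le_rpow (by norm_num) hp2 hδ.le
      have h2 : 1 + (e : ℝ) * (δ * Real.log 2) ≤ ((p : ℝ) ^ δ) ^ e :=
        (one_add_mul_le_pow (by linarith) e).trans (pow_le_pow_left₀ (by linarith) h1 e)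
      have h3 : c * (1 + (e : ℝ) * (δ * Real.log 2)) ≤ c * ((p : ℝ) ^ δ) ^ e :=
        mul_le_mul_of_nonneg_left h2 hc0.le
      refine le_trans ?_ h3
      have h4 : c * (1 + (e : ℝ) * (δ * Real.log 2)) =
          1 + e + (1 / (δ * Real.log 2) + e * (δ * Real.log 2)) := by
        rw [hc]; field_simp; ring
      rw [h4]
      push_cast
      have : 0 ≤ 1 / (δ * Real.log 2) + e * (δ * Real.log 2) := by positivity
      linarith
    · rw [one_mul]
      have h1 : (2 : ℝ) ≤ (p : ℝ) ^ δ := by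
        have h2 : (2 : ℝ) ^ (1 / δ) ≤ p := hP.trans (by exact_mod_cast not_lt.1 hlt)
        calc (2 : ℝ) = ((2 : ℝ) ^ (1 / δ)) ^ δ := by
              rw [← Real.rpow_mul (by norm_num), one_div_mul_cancel hδ.ne', Real.rpow_one]
          _ ≤ (p : ℝ) ^ δ := Real.rpow_le_rpow (by positivity) h2 hδ.le
      calc ((e + 1 : ℕ) : ℝ) ≤ (2 : ℝ) ^ e := by exact_mod_cast Nat.lt_two_pow_self
        _ ≤ _ := pow_le_pow_left₀ (by norm_num) h1 e
  have hprod : (n : ℝ) ^ δ = ∏ p ∈ n.primeFactors, ((p : ℝ) ^ n.factorization p) ^ δ := by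
    rw [Real.finsetProd_rpow _ _ fun p _ => by positivity]
    congr 1
    conv_lhs => rw [← Nat.prod_factorization_pow_eq_self hn]
    rw [Finsupp.prod, Nat.support_factorization]
    push_cast
    rfl
  rw [Nat.card_divisors hn, hprod]
  push_cast
  calc ∏ p ∈ n.primeFactors, ((n.factorization p : ℝ) + 1)
      ≤ ∏ p ∈ n.primeFactors, ((if p < P then c else 1) * ((p : ℝ) ^ n.factorization p) ^ δ) :=
        Finset.prod_le_prod (fun _ _ => by positivity) fun p hp => by
          simpa using hfac p hp
    _ = (∏ p ∈ n.primeFactors, if p < P then c else 1) *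
          ∏ p ∈ n.primeFactors, ((p : ℝ) ^ n.factorization p) ^ δ := Finset.prod_mul_distrib
    _ ≤ c ^ P * ∏ p ∈ n.primeFactors, ((p : ℝ) ^ n.factorization p) ^ δ := by
        refine mul_le_mul_of_nonneg_right ?_ (Finset.prod_nonneg fun _ _ => by positivity)
        rw [← Finset.prod_filter, Finset.prod_const]
        refine pow_le_pow_right₀ hc1 ?_
        calc _ ≤ (Finset.range P).card := Finset.card_le_card fun p hp => by
              simpa using (Finset.mem_filter.1 hp).2
          _ = P := Finset.card_range P

/-! ### The asymptotic formula -/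

theorem abs_mul_coprimeCount_sub_le (M : ℕ) {g : ℕ} (hg : 0 < g) :
    |(g : ℝ) * coprimeCount (M / g) - 4 * ((riemannZeta 2).re)⁻¹ * (M : ℝ) ^ 2 * (1 / g)| ≤
      16 * M * (1 + Real.log M) := by
  have hg0 : (0 : ℝ) < g := by exact_mod_cast hg
  obtain ⟨hz0, hz1⟩ := inv_riemannZeta_two_re_mem
  have hR := abs_coprimeCount_sub_le (M / g)
  set z := ((riemannZeta 2).re)⁻¹
  have hq1 : ((M / g : ℕ) : ℝ) ≤ M / g := Nat.cast_div_le
  have hq2 : (M : ℝ) / g < (M / g : ℕ) + 1 := by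
    rw [div_lt_iff₀ hg0]
    have : (M : ℝ) < (M / g : ℕ) * g + g := by
      exact_mod_cast Nat.lt_div_mul_add hg (a := M)
    linarith
  have hlogM : 0 ≤ Real.log M := Real.log_natCast_nonneg M
  have hlog : Real.log (M / g : ℕ) ≤ Real.log M := by
    rcases Nat.eq_zero_or_pos (M / g) with h0 | h0
    · rw [h0]; simpa using hlogM
    · exact Real.log_le_log (by exact_mod_cast h0) (by exact_mod_cast Nat.div_le_self M g)
  have hq0 : (0 : ℝ) ≤ ((M / g : ℕ) : ℝ) := Nat.cast_nonneg _
  set q : ℝ := ((M / g : ℕ) : ℝ)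
  set x : ℝ := (M : ℝ) / g with hx
  have hx0 : 0 ≤ x := hq0.trans hq1
  have hM : (M : ℝ) = g * x := by rw [hx]; field_simp
  have h1 : |(coprimeCount (M / g) : ℝ) - 4 * z * q ^ 2| ≤ 8 * x * (1 + Real.log M) := by
    refine hR.trans ?_
    gcongr
  have h2 : |4 * z * q ^ 2 - 4 * z * x ^ 2| ≤ 8 * x := by
    have h3 : 0 ≤ x ^ 2 - q ^ 2 := by nlinarith
    have h4 : x ^ 2 - q ^ 2 ≤ 2 * x := by nlinarith
    rw [abs_le]
    constructor <;> nlinarith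
  have h5 := abs_sub_le (coprimeCount (M / g) : ℝ) (4 * z * q ^ 2) (4 * z * x ^ 2)
  calc _ = |(g : ℝ) * ((coprimeCount (M / g) : ℝ) - 4 * z * x ^ 2)| := by
        congr 1; rw [hM]; field_simp
    _ = (g : ℝ) * |(coprimeCount (M / g) : ℝ) - 4 * z * x ^ 2| := by rw [abs_mul, abs_of_pos hg0]
    _ ≤ g * (8 * x * (1 + Real.log M) + 8 * x) := by gcongr; linarith
    _ ≤ g * (16 * x * (1 + Real.log M)) := by
        gcongr
        nlinarith [mul_nonneg hx0 hlogM]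
    _ = _ := by rw [hM]; ring

theorem sum_divisors_eq_mul {h : ℕ} :
    ((∑ d ∈ h.divisors, d : ℕ) : ℝ) = h * ∑ d ∈ h.divisors, (1 : ℝ) / d := by
  rw [← Nat.sum_div_divisors h fun d => d, Finset.mul_sum]
  push_cast
  refine Finset.sum_congr rfl fun d hd => ?_
  have hd0 : (d : ℝ) ≠ 0 := by exact_mod_cast (Nat.pos_of_mem_divisors hd).ne'
  rw [Nat.cast_div (Nat.dvd_of_mem_divisors hd) hd0]
  ring

/-- The asymptotic formula when `h` lies between consecutive squares. -/
theorem abs_detCount_sub_le {h M : ℕ} (h1 : M ^ 2 < h) (h2 : h ≤ (M + 1) ^ 2) :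
    |(detCount h M : ℝ) - (8 * ((riemannZeta 2).re)⁻¹ * (M : ℝ) ^ 2 - 4 * h) *
      ∑ d ∈ h.divisors, (1 : ℝ) / d| ≤
      32 * (M * (1 + Real.log M) * h.divisors.card) +
        48 * ((M + 1 : ℕ) * (M + 1).divisors.card) := by
  have hh : 0 < h := by omega
  have e1 : (detCount h M : ℝ) + 4 * (h * ∑ d ∈ h.divisors, (1 : ℝ) / d) =
      2 * ∑ g ∈ h.divisors, (g : ℝ) * coprimeCount (M / g) +
        4 * ((latticeIndex h).filter fun i => primsInBox h M i = ∅).card := by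
    rw [← sum_divisors_eq_mul]
    have := detCount_add_four_mul h1
    rw [sum_card_primsInBox hh] at this
    exact_mod_cast this
  have e2 : (((latticeIndex h).filter fun i => primsInBox h M i = ∅).card : ℝ) ≤
      12 * ((M + 1 : ℕ) * (M + 1).divisors.card) := by
    have := (card_filter_primsInBox_eq_empty_le hh h2).trans (sum_gcd_boxShell_le M.succ_pos)
    rw [← mul_assoc]
    exact_mod_cast this
  have e3 : |∑ g ∈ h.divisors, (g : ℝ) * coprimeCount (M / g) -
      4 * ((riemannZeta 2).re)⁻¹ * (M : ℝ) ^ 2 * ∑ d ∈ h.divisors, (1 : ℝ) / d| ≤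
      16 * (M * (1 + Real.log M) * h.divisors.card) := by
    rw [Finset.mul_sum, ← Finset.sum_sub_distrib]
    refine (Finset.abs_sum_le_sum_abs _ _).trans ?_
    refine (Finset.sum_le_card_nsmul _ _ _ fun g hg =>
      abs_mul_coprimeCount_sub_le M (Nat.pos_of_mem_divisors hg)).trans (le_of_eq ?_)
    rw [nsmul_eq_mul]; ring
  have e4 : (0 : ℝ) ≤ ((latticeIndex h).filter fun i => primsInBox h M i = ∅).card :=
    Nat.cast_nonneg _
  rw [abs_le] at e3 ⊢
  constructor <;> linarith [e3.1, e3.2]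

theorem exists_sq_lt_le_succ_sq {h : ℕ} (hh : 0 < h) : ∃ M : ℕ, M ^ 2 < h ∧ h ≤ (M + 1) ^ 2 := by
  refine ⟨Nat.sqrt (h - 1), ?_, ?_⟩
  · have := Nat.sqrt_le' (h - 1); omega
  · have := Nat.succ_le_succ_sqrt' (h - 1)
    omega

theorem corollary1p4 :
    ∀ A : ℝ, 0 < A → ∀ ε : ℝ, 0 < ε → ∃ C : ℝ, 0 < C ∧
      ∀ h N : ℕ, 1 ≤ h → 1 ≤ N → |(h : ℝ) - (N : ℝ) ^ 2| ≤ A * (N : ℝ) →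
        |detError h N| ≤ C * (N : ℝ) ^ (1 + ε) := by
  intro A hA ε hε
  set δ := ε / 3 with hδ
  have hδ0 : 0 < δ := by positivity
  obtain ⟨D, hD, hdiv⟩ := exists_card_divisors_le hδ0
  obtain ⟨k, hk⟩ := exists_nat_ge (A + 1)
  have hk1 : (1 : ℝ) ≤ k := by linarith
  refine ⟨(32 * (D * (1 + 1 / δ)) + 48 * D + k * (120 * D) + (16 * k + 4 * A) * D) *
    (1 + k) ^ (1 + ε), by positivity, fun h N hh hN hhN => ?_⟩
  obtain ⟨M, hM1, hM2⟩ := exists_sq_lt_le_succ_sq hh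
  have hM1' : (M : ℝ) ^ 2 < h := by exact_mod_cast hM1
  have hM2' : (h : ℝ) ≤ ((M : ℝ) + 1) ^ 2 := by exact_mod_cast hM2
  have hN1 : (1 : ℝ) ≤ N := by exact_mod_cast hN
  have hM0 : (0 : ℝ) ≤ M := Nat.cast_nonneg M
  obtain ⟨hhN1, hhN2⟩ := abs_le.1 hhN
  -- the box sizes `M ≈ √h` and `N` differ by at most `k`
  have hMN : (M : ℝ) + 1 ≤ N + k := by
    have : (M : ℝ) < N + A := by
      refine lt_of_pow_lt_pow_left₀ 2 (by positivity) ?_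
      nlinarith
    linarith
  have hNM : (N : ℝ) ≤ M + k := by
    by_contra! hc
    have h1 : (M : ℝ) + 1 + A < N + 1 := by linarith
    have h2 : (M : ℝ) + 1 ≤ N - A := by linarith
    have h3 : ((M : ℝ) + 1) ^ 2 ≤ (N - A) ^ 2 := pow_le_pow_left₀ (by positivity) h2 2
    nlinarith
  set L : ℝ := N + k with hL
  have hL1 : 1 ≤ L := by linarith
  have hL0 : 0 < L := by linarith
  set P : ℝ := L ^ (1 + ε) with hP
  have hPpos : 0 < P := Real.rpow_pos_of_pos hL0 _
  have hLpow : ∀ e : ℝ, 1 + e ≤ 1 + ε → L * L ^ e ≤ P := by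
    intro e he
    calc L * L ^ e = L ^ (1 + e) := by rw [Real.rpow_add hL0, Real.rpow_one]
      _ ≤ P := Real.rpow_le_rpow_of_exponent_le hL1 he
  have hB : ∀ B : ℕ, 0 < B → (B : ℝ) ≤ L → (B : ℝ) * B.divisors.card ≤ D * P := by
    intro B hB0 hBL
    calc (B : ℝ) * B.divisors.card ≤ L * (D * L ^ δ) := by
          gcongr
          exact (hdiv B hB0.ne').trans (by gcongr)
      _ = D * (L * L ^ δ) := by ring
      _ ≤ D * P := by gcongr; exact hLpow _ (by linarith)
  have hτ : (h.divisors.card : ℝ) ≤ D * L ^ (2 * δ) := by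
    refine (hdiv h (by omega)).trans ?_
    have : (h : ℝ) ≤ L ^ 2 := hM2'.trans (pow_le_pow_left₀ (by positivity) hMN 2)
    gcongr
    calc (h : ℝ) ^ δ ≤ (L ^ 2) ^ δ := by gcongr
      _ = L ^ (2 * δ) := by rw [← Real.rpow_natCast, ← Real.rpow_mul hL0.le]; norm_num
  have hτL : L * (h.divisors.card : ℝ) ≤ D * P := by
    calc L * (h.divisors.card : ℝ) ≤ L * (D * L ^ (2 * δ)) := by gcongr
      _ = D * (L * L ^ (2 * δ)) := by ring
      _ ≤ D * P := by gcongr; exact hLpow _ (by linarith)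
  have hlog : 1 + Real.log M ≤ (1 + 1 / δ) * L ^ δ := by
    have h1 : Real.log M ≤ L ^ δ / δ := by
      refine (Real.log_le_rpow_div hM0 hδ0).trans ?_
      gcongr
      linarith
    have h2 : 1 ≤ L ^ δ := Real.one_le_rpow hL1 hδ0.le
    calc 1 + Real.log M ≤ L ^ δ + L ^ δ / δ := add_le_add h2 h1
      _ = _ := by ring
  have hmain : M * (1 + Real.log M) * h.divisors.card ≤ D * (1 + 1 / δ) * P := by
    have h0 : 0 ≤ 1 + Real.log M := by linarith [Real.log_natCast_nonneg M]
    calc M * (1 + Real.log M) * h.divisors.card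
        ≤ L * ((1 + 1 / δ) * L ^ δ) * (D * L ^ (2 * δ)) := by
          gcongr
          linarith
      _ = D * (1 + 1 / δ) * (L * (L ^ δ * L ^ (2 * δ))) := by ring
      _ ≤ D * (1 + 1 / δ) * P := by
          rw [← Real.rpow_add hL0]
          gcongr
          exact hLpow _ (by linarith)
  have E1 := abs_detCount_sub_le hM1 hM2
  have hMN' : M ≤ N + k := by exact_mod_cast (show (M : ℝ) ≤ N + k by linarith)
  have E2 := abs_detCount_sub_detCount_le (h := h) (k := k) (M := M) (N := N) hB (by positivity)
    (by linarith) (by linarith) hMN' (by exact_mod_cast hNM)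
  have E3 := hB (M + 1) M.succ_pos (by push_cast; exact hMN)
  obtain ⟨hz0, hz1⟩ := inv_riemannZeta_two_re_mem
  set z := ((riemannZeta 2).re)⁻¹ with hz
  set S := ∑ d ∈ h.divisors, (1 : ℝ) / d with hS
  have hS0 : 0 ≤ S := Finset.sum_nonneg fun d _ => by positivity
  have hS1 : S ≤ h.divisors.card := by
    rw [Finset.card_eq_sum_ones, Nat.cast_sum]
    refine Finset.sum_le_sum fun d hd => ?_
    have : (1 : ℝ) ≤ d := by exact_mod_cast Nat.pos_of_mem_divisors hd
    simpa using inv_le_one_of_one_le₀ this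
  have hsq : |(M : ℝ) ^ 2 - (N : ℝ) ^ 2| ≤ 2 * k * L := by
    have h1 : |(M : ℝ) - N| ≤ k := abs_le.2 ⟨by linarith, by linarith⟩
    have h2 : |(M : ℝ) + N| ≤ 2 * L := by rw [abs_of_nonneg (by positivity)]; linarith
    calc |(M : ℝ) ^ 2 - (N : ℝ) ^ 2| = |(M : ℝ) - N| * |(M : ℝ) + N| := by
          rw [← abs_mul]; congr 1; ring
      _ ≤ k * (2 * L) := by gcongr
      _ = _ := by ring
  have E4 : |(8 * z * (M : ℝ) ^ 2 - 4 * h) * S - (8 * z - 4) * (N : ℝ) ^ 2 * S| ≤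
      (16 * k + 4 * A) * (D * P) := by
    have h1 : |8 * z * ((M : ℝ) ^ 2 - (N : ℝ) ^ 2) - 4 * (h - (N : ℝ) ^ 2)| ≤
        (16 * k + 4 * A) * L := by
      refine (abs_sub _ _).trans ?_
      rw [abs_mul, abs_mul, abs_mul, abs_of_nonneg hz0]
      norm_num only [abs_of_pos]
      have h2 : z * |(M : ℝ) ^ 2 - (N : ℝ) ^ 2| ≤ 1 * (2 * k * L) := by gcongr
      have h3 : A * (N : ℝ) ≤ A * L := by gcongr; linarith
      linarith
    calc _ = |8 * z * ((M : ℝ) ^ 2 - (N : ℝ) ^ 2) - 4 * (h - (N : ℝ) ^ 2)| * S := by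
          rw [← abs_of_nonneg hS0, ← abs_mul, abs_of_nonneg hS0]; congr 1; ring
      _ ≤ (16 * k + 4 * A) * L * h.divisors.card := by gcongr
      _ = (16 * k + 4 * A) * (L * h.divisors.card) := by ring
      _ ≤ _ := by gcongr
  have hPN : P ≤ (1 + k) ^ (1 + ε) * (N : ℝ) ^ (1 + ε) := by
    rw [← Real.mul_rpow (by positivity) (by positivity)]
    refine Real.rpow_le_rpow hL0.le ?_ (by positivity)
    nlinarith
  have hfinal : |detError h N| ≤
      (32 * (D * (1 + 1 / δ)) + 48 * D + k * (120 * D) + (16 * k + 4 * A) * D) * P := by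
    have hdef : detError h N = (detCount h N : ℝ) - (8 * z - 4) * (N : ℝ) ^ 2 * S := rfl
    rw [hdef]
    have t1 := abs_sub_le (detCount h N : ℝ) (detCount h M) ((8 * z - 4) * (N : ℝ) ^ 2 * S)
    have t2 := abs_sub_le (detCount h M : ℝ) ((8 * z * (M : ℝ) ^ 2 - 4 * h) * S)
      ((8 * z - 4) * (N : ℝ) ^ 2 * S)
    linarith
  calc _ ≤ _ := hfinal
    _ ≤ (32 * (D * (1 + 1 / δ)) + 48 * D + k * (120 * D) + (16 * k + 4 * A) * D) *
        ((1 + k) ^ (1 + ε) * (N : ℝ) ^ (1 + ε)) := by gcongr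
    _ = _ := by ring
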